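/- **Setting.** Let $\mathcal C=\{C_1,\dots,C_n\}$, $n\ge 1$, be pairwise disjoint, nonempty, closed, convex subsets of $\mathbb R^2$ such that the distance between any two of them is attained (for instance, compact sets). For a finite set $S\subset\mathbb R^2$ of centers, the radius of $S$ is $\max_i\min_{s\in S} d(s,C_i)$, with value $\infty$ if $S=\emptyset$. For an integer $k\ge 0$, a set of at most $k$ centers is *optimal for $k$* if its radius is least among all sets of at most $k$ points of the plane; this radius is $r_{opt}(k)$. The *bisector* of $C_i$ and $C_j$ ($i\ne j$) is $\beta_{ij}=\{x: d(x,C_i)=d(x,C_j)\}$. Let $T_{ij}$ be the set of all $p\in\beta_{ij}$ with $d(p,C_l)=d(p,C_i)$ for some third object $C_l$ (three-way equidistant points). An *arc* of $\beta_{ij}$ is the closure of a connected component of $\beta_{ij}\setminus T_{ij}$. The objects have constant complexity and are in general position in the following sense: for a constant $c$, any three distinct objects have at most $c$ common equidistant points, i.e. $|\beta_{ij}\cap\beta_{il}|\le c$ for all distinct $i,j,l$. **Machine model.** A real RAM with unit-cost instructions on natural numbers (constants, copying, addition, truncated subtraction, comparison, direct and indirect addressing), on real numbers (integer constants, copying,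 the four arithmetic operations, comparison), and on points (copying, forming from and splitting into coordinates), and with the following geometric primitives, each on at most three input objects given by their indices and each at unit cost: return some point of an object; return the distance from a point to an object; return some point of the bisector of two objects at minimum distance from them; return the number, or the $\ell$-th point in some fixed list, of the points equidistant from three objects. The input is $n$, with access to the objects through the primitives only; points and radii are output one at a time. **Lemma.** There is a single program which, for every such $\mathcal C$, halts after $O(n^3\log (n+1))$ steps (so $O(n^3\log n)$ for $n\geq 2$), having output a set $P$ of $O(n^3)$ points and a set $R$ of $O(n^3)$ real numbers, where the implied constants depend only on $c$, such that: 1. For every integer $k\ge 0$ there is a set $S\subseteq P$ with $|S|=\min(k,|P|)$ that is optimal for $k$; and if $k\ge1$ then its radius $r_{opt}(k)$ is finite and belongs to $R$. The sets $P$ and $R$ are the same for all $k$. 2. Every point of $P$ lies in one of the objects, or is a three-way equidistant point in some $T_{ij}$, or is a point of some arc of some bisector $\beta_{ij}$ at minimum distance from $C_i$ among all points of that arc. Every element of $R$ is $0$ or is $d(p,C_i)$ for a point $p\in P$ of one of the last two kinds on a bisector $\beta_{ij}$. 3. Conversely, $P$ contains a point of each object, all points of all sets $T_{ij}$, and, for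 each arc of each bisector $\beta_{ij}$, a point of that arc at minimum distance from $C_i$. -/

import Mathlib

open Set Metric
open scoped ENNReal

noncomputable section

namespace Clustering

/-- The Euclidean plane. -/
abbrev Plane : Type := EuclideanSpace ℝ (Fin 2)

/-! ### Clustering with neighborhoods -/

/-- The radius of a finite set `S` of centers: the maximum over the objects of the distance from the
object to its nearest center.  It is `⊤` when there are objects but no centers. -/
def radius {n : ℕ} (C : Fin n → Set Plane) (S : Finset Plane) : ℝ≥0∞ :=
  ⨆ i, ⨅ s ∈ S, infEDist s (C i)

/-- `S` attains the least radius among all sets of at most `k` centers in the plane. -/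
def IsOptimal {n : ℕ} (C : Fin n → Set Plane) (k : ℕ) (S : Finset Plane) : Prop :=
  S.card ≤ k ∧ ∀ S' : Finset Plane, S'.card ≤ k → radius C S ≤ radius C S'

/-! ### Bisectors -/

/-- The bisector of two sets. -/
def bisector (A B : Set Plane) : Set Plane :=
  {x | infDist x A = infDist x B}

/-- The points that are at the same distance from three sets. -/
def equidistantPoints (A B D : Set Plane) : Set Plane :=
  bisector A B ∩ bisector A D

/-- The points of the bisector of `C i` and `C j` that are as far from some third object. -/
def tiePoints {n : ℕ} (C : Fin n → Set Plane) (i j : Fin n) : Set Plane :=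
  {p | ∃ l, l ≠ i ∧ l ≠ j ∧ p ∈ equidistantPoints (C i) (C j) (C l)}

/-- `K` is one of the closed arcs into which the points of `tiePoints C i j` cut the bisector of
`C i` and `C j`: the closure of a connected component of what is left of the bisector when these
points are removed. -/
def IsArc {n : ℕ} (C : Fin n → Set Plane) (i j : Fin n) (K : Set Plane) : Prop :=
  ∃ x ∈ bisector (C i) (C j) \ tiePoints C i j,
    K = closure (connectedComponentIn (bisector (C i) (C j) \ tiePoints C i j) x)

/-- `p` is a point of `K` at minimum distance from `A`. -/
def IsDistMin (A K : Set Plane) (p : Plane) : Prop :=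
  p ∈ K ∧ ∀ q ∈ K, infDist p A ≤ infDist q A

/-- `p` is a candidate on the bisector of `C i` and `C j`: either a point equidistant to a third
object, or a point of minimum distance on an arc between consecutive such points. -/
def IsBisectorCandidate {n : ℕ} (C : Fin n → Set Plane) (i j : Fin n) (p : Plane) : Prop :=
  p ∈ tiePoints C i j ∨ ∃ K, IsArc C i j K ∧ IsDistMin (C i) K p

/-- The input: pairwise disjoint, nonempty, closed convex sets in the plane such that the distance
of any two of them is a minimum, and such that the bisectors of an object with two others meet in
at most `c` points. -/
structure IsInput {n : ℕ} (c : ℕ) (C : Fin n → Set Plane) : Prop where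
  nonempty : ∀ i, (C i).Nonempty
  closed : ∀ i, IsClosed (C i)
  convex : ∀ i, Convex ℝ (C i)
  disjoint : ∀ i j, i ≠ j → Disjoint (C i) (C j)
  attained : ∀ i j, ∃ x ∈ C i, ∃ y ∈ C j, ∀ x' ∈ C i, ∀ y' ∈ C j, dist x y ≤ dist x' y'
  meet : ∀ i j l, i ≠ j → i ≠ l → j ≠ l →
    (equidistantPoints (C i) (C j) (C l)).encard ≤ c

/-! ### Geometric primitives

Each of them concerns at most three input objects. -/

/-- The object with number `a` (numbers that name no object yield the empty set). -/
def object {n : ℕ} (C : Fin n → Set Plane) (a : ℕ) : Set Plane :=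
  if h : a < n then C ⟨a, h⟩ else ∅

/-- Some point of `A`. -/
def somePoint (A : Set Plane) : Plane :=
  Classical.epsilon fun p => p ∈ A

/-- Some point of the bisector of `A` and `B` at minimum distance from `A` and `B`. -/
def bisectorMin (A B : Set Plane) : Plane :=
  Classical.epsilon fun p => IsDistMin A (bisector A B) p

open Classical in
/-- The points equidistant to three sets, listed in some order (if there are finitely many). -/
def equidistantList (A B D : Set Plane) : List Plane :=
  if h : (equidistantPoints A B D).Finite then h.toFinset.toList else []

/-! ### The machine

A real RAM: three memories, for natural numbers, for reals and for points, with direct and indirect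
addressing, and write-only output.  Programs are structured; every instruction and every evaluation
of a test takes one step. -/

/-- Memory addresses: `cell a` is the cell `a`, and `ind a` is the cell whose address is stored in
cell `a` of the memory for natural numbers. -/
inductive Addr : Type
  | cell (a : ℕ)
  | ind (a : ℕ)

/-- The configuration of the machine, together with what has been output so far. -/
structure State : Type where
  num : ℕ → ℕ
  real : ℕ → ℝ
  pt : ℕ → Plane
  outPts : List Plane
  outRadii : List ℝ

/-- The cell that an address denotes. -/
def State.loc (s : State) : Addr → ℕ
  | .cell a => a
  | .ind a => s.num a

/-- The natural number stored at an address. -/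
def State.getNum (s : State) (a : Addr) : ℕ := s.num (s.loc a)

/-- The real number stored at an address. -/
def State.getReal (s : State) (a : Addr) : ℝ := s.real (s.loc a)

/-- The point stored at an address. -/
def State.getPt (s : State) (a : Addr) : Plane := s.pt (s.loc a)

/-- Overwrite a natural number. -/
def State.putNum (s : State) (d : Addr) (v : ℕ) : State :=
  { s with num := Function.update s.num (s.loc d) v }

/-- Overwrite a real number. -/
def State.putReal (s : State) (d : Addr) (v : ℝ) : State :=
  { s with real := Function.update s.real (s.loc d) v }

/-- Overwrite a point. -/
def State.putPt (s : State) (d : Addr) (v : Plane) : State :=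
  { s with pt := Function.update s.pt (s.loc d) v }

/-- The instructions.  The argument `d` is the address of the result; the arguments `o`, `o'`, `o''`
are addresses of numbers of objects. -/
inductive Instr : Type
  | setNum (d : Addr) (v : ℕ)
  | copyNum (d a : Addr)
  | addNum (d a b : Addr)
  | subNum (d a b : Addr)
  | setReal (d : Addr) (v : ℤ)
  | copyReal (d a : Addr)
  | addReal (d a b : Addr)
  | subReal (d a b : Addr)
  | mulReal (d a b : Addr)
  | divReal (d a b : Addr)
  | copyPt (d a : Addr)
  | makePt (d x y : Addr)
  | coord (d a : Addr) (e : Fin 2)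
  | somePoint (d o : Addr)
  | distance (d a o : Addr)
  | bisectorMin (d o o' : Addr)
  | countEquidistant (d o o' o'' : Addr)
  | equidistant (d o o' o'' l : Addr)
  | outPt (a : Addr)
  | outRadius (a : Addr)

/-- The effect of an instruction on inputs `C`. -/
def Instr.apply {n : ℕ} (C : Fin n → Set Plane) (s : State) : Instr → State
  | .setNum d v => s.putNum d v
  | .copyNum d a => s.putNum d (s.getNum a)
  | .addNum d a b => s.putNum d (s.getNum a + s.getNum b)
  | .subNum d a b => s.putNum d (s.getNum a - s.getNum b)
  | .setReal d v => s.putReal d v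
  | .copyReal d a => s.putReal d (s.getReal a)
  | .addReal d a b => s.putReal d (s.getReal a + s.getReal b)
  | .subReal d a b => s.putReal d (s.getReal a - s.getReal b)
  | .mulReal d a b => s.putReal d (s.getReal a * s.getReal b)
  | .divReal d a b => s.putReal d (s.getReal a / s.getReal b)
  | .copyPt d a => s.putPt d (s.getPt a)
  | .makePt d x y => s.putPt d (!₂[s.getReal x, s.getReal y])
  | .coord d a e => s.putReal d (s.getPt a e)
  | .somePoint d o => s.putPt d (Clustering.somePoint (object C (s.getNum o)))
  | .distance d a o => s.putReal d (infDist (s.getPt a) (object C (s.getNum o)))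
  | .bisectorMin d o o' =>
      s.putPt d (Clustering.bisectorMin (object C (s.getNum o)) (object C (s.getNum o')))
  | .countEquidistant d o o' o'' =>
      s.putNum d (equidistantList (object C (s.getNum o)) (object C (s.getNum o'))
        (object C (s.getNum o''))).length
  | .equidistant d o o' o'' l =>
      s.putPt d ((equidistantList (object C (s.getNum o)) (object C (s.getNum o'))
        (object C (s.getNum o''))).getD (s.getNum l) 0)
  | .outPt a => { s with outPts := s.getPt a :: s.outPts }
  | .outRadius a => { s with outRadii := s.getReal a :: s.outRadii }

/-- The tests: comparisons of two natural or two real numbers. -/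
inductive Test : Type
  | numLt (a b : Addr)
  | realLt (a b : Addr)

/-- The outcome of a test. -/
def Test.Holds (s : State) : Test → Prop
  | .numLt a b => s.getNum a < s.getNum b
  | .realLt a b => s.getReal a < s.getReal b

/-- Programs. -/
inductive Program : Type
  | instr (o : Instr)
  | seq (p q : Program)
  | ite (b : Test) (p q : Program)
  | loop (b : Test) (p : Program)

/-- `Run C p s s' t`: on inputs `C`, the program `p` started in `s` halts in `s'` after `t` steps. -/
inductive Run {n : ℕ} (C : Fin n → Set Plane) : Program → State → State → ℕ → Prop
  | instr (o : Instr) (s : State) : Run C (.instr o) s (o.apply C s) 1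
  | seq {p q : Program} {s s' s'' : State} {t t' : ℕ} (hp : Run C p s s' t)
      (hq : Run C q s' s'' t') : Run C (.seq p q) s s'' (t + t')
  | iteTrue {b : Test} {p q : Program} {s s' : State} {t : ℕ} (hb : b.Holds s)
      (hp : Run C p s s' t) : Run C (.ite b p q) s s' (t + 1)
  | iteFalse {b : Test} {p q : Program} {s s' : State} {t : ℕ} (hb : ¬ b.Holds s)
      (hq : Run C q s s' t) : Run C (.ite b p q) s s' (t + 1)
  | loopStop {b : Test} {p : Program} {s : State} (hb : ¬ b.Holds s) :
      Run C (.loop b p) s s 1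
  | loopStep {b : Test} {p : Program} {s s' s'' : State} {t t' : ℕ} (hb : b.Holds s)
      (hp : Run C p s s' t) (hl : Run C (.loop b p) s' s'' t') :
      Run C (.loop b p) s s'' (t + t' + 1)

/-- The initial state: cell 0 holds the number of objects, all else is zero or empty. -/
def startState (n : ℕ) : State where
  num := Function.update (fun _ => 0) 0 n
  real := fun _ => 0
  pt := fun _ => 0
  outPts := []
  outRadii := []

open Classical in
/-- On inputs `C` the program halts after `t` steps, having output the points `P` and the
radii `R`. -/
def Computes {n : ℕ} (C : Fin n → Set Plane) (p : Program) (t : ℕ) (P : Finset Plane)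
    (R : Finset ℝ) : Prop :=
  ∃ s : State, Run C p (startState n) s t ∧ P = s.outPts.toFinset ∧ R = s.outRadii.toFinset

end Clustering

end

namespace Clustering

/-! ### Nearest points -/

/-! Fix a center `s` and the set `I` of objects it serves within radius `r`. If `I` has at most one
element, a point of that object serves it at radius 0. Otherwise move `s` towards its farthest
object `C i` until some other object `C j` of `I` is equally far (`exists_equidistant_of_two_le`).
The new center lies on a bisector, its distance to `C i` has not grown, and no object of `I` is
farther than `C i`. On an arc the comparison of another object with `C i` cannot change sign, since
a change would produce a tie (`infDist_le_on_arc`). So the center may be moved to the point of its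
arc nearest to `C i`. Replacing every center in this way keeps an optimal set optimal, and its
radius is a candidate radius (`exists_candidates`).

What makes this computable is that one global minimum per bisector, together with the ties, supplies
a minimum on every arc (`IsArc.exists_isDistMin`). The reason is that sublevel sets of the distance
on a bisector are path connected. The distance to a convex set is convex, so the segment between two
points of the bisector stays below the larger level, and a retraction of the plane onto the bisector
that does not increase the larger of the two distances pushes this segment into the bisector
(`exists_retraction`, `exists_path_bisector`). Walking from a point of an arc to the global minimum,
one either arrives without leaving the closed arc or meets a tie on it, at no greater distance.

The program enumerates objects, pairs and triples with strictly decreasing indices. Each triple has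
at most `c` ties, so `n ^ 3` steps suffice up to a constant, without the logarithm. -/

/-- A point of `A` nearest to `x`. -/
noncomputable def nearest (A : Set Plane) (x : Plane) : Plane :=
  Classical.epsilon fun a => a ∈ A ∧ infDist x A = dist x a

theorem nearest_spec {A : Set Plane} (hc : IsClosed A) (hne : A.Nonempty) (x : Plane) :
    nearest A x ∈ A ∧ infDist x A = dist x (nearest A x) :=
  Classical.epsilon_spec (p := fun a => a ∈ A ∧ infDist x A = dist x a)
    (hc.exists_infDist_eq_dist hne x)

theorem inner_nearest_le_zero {A : Set Plane} (hc : IsClosed A) (hne : A.Nonempty)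
    (hA : Convex ℝ A) (x : Plane) {w : Plane} (hw : w ∈ A) :
    inner ℝ (x - nearest A x) (w - nearest A x) ≤ 0 := by
  have h := nearest_spec hc hne x
  refine (norm_eq_iInf_iff_real_inner_le_zero hA h.1).1 ?_ w hw
  rw [← dist_eq_norm, ← h.2, infDist_eq_iInf]
  simp only [dist_eq_norm]

/-- Adding the obtuse-angle inequalities at the two projections gives `‖a - b‖ ^ 2 ≤ ⟪x - y, a -
b⟫`; Cauchy–Schwarz finishes. -/
theorem dist_nearest_le {A : Set Plane} (hc : IsClosed A) (hne : A.Nonempty)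
    (hA : Convex ℝ A) (x y : Plane) : dist (nearest A x) (nearest A y) ≤ dist x y := by
  set a := nearest A x with ha
  set b := nearest A y with hb
  have h1 := inner_nearest_le_zero hc hne hA x (nearest_spec hc hne y).1
  have h2 := inner_nearest_le_zero hc hne hA y (nearest_spec hc hne x).1
  rw [← ha, ← hb] at h1 h2
  have h3 : inner ℝ (a - b) (a - b) ≤ (inner ℝ (x - y) (a - b) : ℝ) := by
    have e : (inner ℝ (x - y) (a - b) : ℝ) - inner ℝ (a - b) (a - b)
        = - inner ℝ (x - a) (b - a) - inner ℝ (y - b) (a - b) := by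
      rw [← inner_sub_left, ← neg_sub a b, inner_neg_right, neg_neg, ← inner_sub_left]
      congr 1
      abel
    linarith
  rw [real_inner_self_eq_norm_sq] at h3
  have h4 := h3.trans (real_inner_le_norm _ _)
  rw [dist_eq_norm, dist_eq_norm]
  by_contra! h
  nlinarith [norm_nonneg (x - y)]

theorem continuous_nearest {A : Set Plane} (hc : IsClosed A) (hne : A.Nonempty)
    (hA : Convex ℝ A) : Continuous (nearest A) :=
  (LipschitzWith.of_dist_le_mul (K := 1) fun x y => by
    simpa using dist_nearest_le hc hne hA x y).continuous

theorem infDist_lineMap_le {A : Set Plane} (hc : IsClosed A) (hne : A.Nonempty)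
    (hA : Convex ℝ A) (x y : Plane) {t : ℝ} (ht : t ∈ Icc (0 : ℝ) 1) :
    infDist (AffineMap.lineMap x y t) A ≤ (1 - t) * infDist x A + t * infDist y A := by
  have hx := nearest_spec hc hne x
  have hy := nearest_spec hc hne y
  have hz := hA.lineMap_mem hx.1 hy.1 ht
  refine (infDist_le_dist_of_mem hz).trans ?_
  rw [hx.2, hy.2, AffineMap.lineMap_apply_module, AffineMap.lineMap_apply_module]
  refine (dist_add_add_le _ _ _ _).trans ?_
  rw [dist_smul₀, dist_smul₀, Real.norm_of_nonneg ht.1, Real.norm_of_nonneg (by linarith [ht.2])]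

theorem infDist_lineMap_nearest {A : Set Plane} {x a : Plane} (ha : a ∈ A)
    (hxa : infDist x A = dist x a) {t : ℝ} (ht : t ∈ Icc (0 : ℝ) 1) :
    infDist (AffineMap.lineMap x a t) A = (1 - t) * infDist x A := by
  have e : dist (AffineMap.lineMap x a t) a = (1 - t) * dist x a := by
    rw [dist_lineMap_right, Real.norm_of_nonneg (by linarith [ht.2])]
  have e' : dist x (AffineMap.lineMap x a t) = t * dist x a := by
    rw [dist_left_lineMap, Real.norm_of_nonneg ht.1]
  refine le_antisymm ((infDist_le_dist_of_mem ha).trans_eq (by rw [e, hxa])) ?_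
  have := infDist_le_infDist_add_dist (s := A) (x := x) (y := AffineMap.lineMap x a t)
  rw [e', hxa] at this
  rw [hxa]
  linarith

theorem mem_bisector {A B : Set Plane} {x : Plane} :
    x ∈ bisector A B ↔ infDist x A = infDist x B := Iff.rfl

theorem bisector_comm (A B : Set Plane) : bisector A B = bisector B A := by
  ext x
  exact eq_comm

theorem isClosed_bisector (A B : Set Plane) : IsClosed (bisector A B) :=
  isClosed_eq (continuous_infDist_pt A) (continuous_infDist_pt B)

/-- Moving from a point `y` of the bisector towards its nearest point in `A`, one gets strictly
closer to `A` than to `B`. -/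
theorem infDist_lt_of_between {A B : Set Plane} (hBc : IsClosed B) (hBn : B.Nonempty)
    (hAB : Disjoint A B) {y u : Plane} {k : ℝ} (hk : 0 ≤ k) (hu : u ≠ 0)
    (hy : y ∈ bisector A B) (ha : y + (1 + k) • u ∈ A)
    (hya : infDist y A = dist y (y + (1 + k) • u)) :
    infDist (y + u) A < infDist (y + u) B := by
  by_contra! h
  obtain ⟨b, hb, hzb⟩ := hBc.exists_infDist_eq_dist hBn (y + u)
  have h1 : infDist (y + u) A ≤ k * ‖u‖ := by
    refine (infDist_le_dist_of_mem ha).trans_eq ?_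
    rw [dist_eq_norm, show y + u - (y + (1 + k) • u) = -(k • u) by module, norm_neg, norm_smul,
      Real.norm_of_nonneg hk]
  have h2 : infDist y B = (1 + k) * ‖u‖ := by
    rw [← hy, hya, dist_eq_norm, sub_add_cancel_left, norm_neg, norm_smul,
      Real.norm_of_nonneg (by linarith)]
  set w := b - (y + u) with hw
  have h3 : ‖w‖ ≤ k * ‖u‖ := by
    rw [hw, ← dist_eq_norm, dist_comm, ← hzb]
    exact h.trans h1
  have h4 : (1 + k) * ‖u‖ ≤ ‖w + u‖ := by
    rw [← h2, hw]
    refine (infDist_le_dist_of_mem hb).trans_eq ?_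
    rw [dist_comm, dist_eq_norm]
    congr 1
    abel
  -- Since `‖w‖ ≤ k‖u‖` and `‖w + u‖ ≥ (1 + k)‖u‖`, the triangle inequality is tight. This forces `w
  -- = k • u`, so that `b` is the given point of `A`, against disjointness.
  have h5 := norm_add_sq_real w u
  have h6 := norm_sub_sq_real w (k • u)
  rw [inner_smul_right, norm_smul, Real.norm_of_nonneg hk] at h6
  have hu0 := norm_nonneg u
  have hku : 0 ≤ k * ‖u‖ := mul_nonneg hk hu0
  have h7 : ‖w‖ ^ 2 ≤ (k * ‖u‖) ^ 2 := by gcongr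
  have h8 : ((1 + k) * ‖u‖) ^ 2 ≤ ‖w + u‖ ^ 2 := by gcongr
  have h9 : k * ‖u‖ ^ 2 ≤ inner ℝ w u := by nlinarith
  have h10 : k * (k * ‖u‖ ^ 2) ≤ k * inner ℝ w u := by gcongr
  have h11 : ‖w - k • u‖ ^ 2 ≤ 0 := by nlinarith
  have h12 : w - k • u = 0 := by
    rw [← norm_eq_zero]
    exact pow_eq_zero_iff (two_ne_zero) |>.1 (le_antisymm h11 (by positivity))
  have h13 : b = y + (1 + k) • u := by
    have : b - (y + (1 + k) • u) = w - k • u := by rw [hw]; module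
    rw [← sub_eq_zero, this, h12]
  exact hAB.ne_of_mem ha hb h13.symm

/-- Every ray from a point to a nearest point of `A` crosses the bisector at most once. -/
theorem eq_of_lineMap_mem_bisector {A B : Set Plane} (hBc : IsClosed B) (hBn : B.Nonempty)
    (hAB : Disjoint A B) {x a : Plane} (ha : a ∈ A) (hxa : infDist x A = dist x a) {s t : ℝ}
    (hs : s ∈ Icc (0 : ℝ) 1) (ht : t ∈ Icc (0 : ℝ) 1)
    (hbs : AffineMap.lineMap x a s ∈ bisector A B)
    (hbt : AffineMap.lineMap x a t ∈ bisector A B) : s = t := by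
  wlog hst : s ≤ t generalizing s t
  · exact (this ht hs hbt hbs (le_of_not_ge hst)).symm
  by_contra hne
  have hlt : s < t := lt_of_le_of_ne hst hne
  have hxa' : x ≠ a := by
    rintro rfl
    simp only [AffineMap.lineMap_same, AffineMap.const_apply, mem_bisector] at hbs
    rw [infDist_zero_of_mem ha] at hbs
    exact hAB.ne_of_mem ha ((hBc.mem_iff_infDist_zero hBn).2 hbs.symm) rfl
  have hd : 0 < t - s := sub_pos.2 hlt
  -- The value of `k` makes `(1 + k) • u = (1 - s) • (a - x)`, the remaining way from parameter `s`
  -- to `a`.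
  have key := infDist_lt_of_between hBc hBn hAB (y := AffineMap.lineMap x a s)
    (u := (t - s) • (a - x)) (k := (1 - t) / (t - s)) (div_nonneg (by linarith [ht.2]) hd.le)
    (smul_ne_zero hd.ne' (sub_ne_zero.2 hxa'.symm)) hbs
  have e : AffineMap.lineMap x a s + (1 + (1 - t) / (t - s)) • (t - s) • (a - x) = a := by
    rw [smul_smul, show (1 + (1 - t) / (t - s)) * (t - s) = 1 - s by field_simp; ring,
      AffineMap.lineMap_apply_module]
    module
  have e' : AffineMap.lineMap x a s + (t - s) • (a - x) = AffineMap.lineMap x a t := by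
    rw [AffineMap.lineMap_apply_module, AffineMap.lineMap_apply_module]
    module
  rw [e, e'] at key
  refine (key ha ?_).ne hbt
  rw [infDist_lineMap_nearest ha hxa hs, dist_lineMap_right,
    Real.norm_of_nonneg (by linarith [hs.2]), hxa]

/-! ### A retraction onto the bisector -/

/-- The point reached from `x` by moving the fraction `t` of the way to the nearest point of `A` if
`t` is positive, and the fraction `-t` of the way to the nearest point of `B` if it is negative. -/
noncomputable def slide (A B : Set Plane) (x : Plane) (t : ℝ) : Plane :=
  x + max t 0 • (nearest A x - x) + max (-t) 0 • (nearest B x - x)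

theorem slide_of_nonneg (A B : Set Plane) (x : Plane) {t : ℝ} (ht : 0 ≤ t) :
    slide A B x t = AffineMap.lineMap x (nearest A x) t := by
  rw [slide, max_eq_left ht, max_eq_right (by linarith), AffineMap.lineMap_apply_module]
  module

theorem slide_of_nonpos (A B : Set Plane) (x : Plane) {t : ℝ} (ht : t ≤ 0) :
    slide A B x t = AffineMap.lineMap x (nearest B x) (-t) := by
  rw [slide, max_eq_right ht, max_eq_left (by linarith), AffineMap.lineMap_apply_module]
  module

theorem slide_zero (A B : Set Plane) (x : Plane) : slide A B x 0 = x := by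
  simp [slide]

theorem slide_neg (A B : Set Plane) (x : Plane) (t : ℝ) : slide A B x (-t) = slide B A x t := by
  rw [slide, slide, neg_neg]
  abel

/-- The parameter `t` takes `x` to the bisector, towards the more distant one of the two sets. -/
def SlidesTo (A B : Set Plane) (x : Plane) (t : ℝ) : Prop :=
  0 ≤ t * (infDist x A - infDist x B) ∧ slide A B x t ∈ bisector A B

theorem SlidesTo.neg {A B : Set Plane} {x : Plane} {t : ℝ} (h : SlidesTo A B x t) :
    SlidesTo B A x (-t) := by
  refine ⟨?_, ?_⟩
  · linarith [h.1]
  · rw [slide_neg, bisector_comm]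
    exact h.2

theorem exists_slidesTo {A B : Set Plane} (hAc : IsClosed A) (hAn : A.Nonempty)
    (hBc : IsClosed B) (hBn : B.Nonempty) (x : Plane) :
    ∃ t ∈ Icc (-1 : ℝ) 1, SlidesTo A B x t := by
  wlog h : infDist x B ≤ infDist x A generalizing A B
  · obtain ⟨t, ht, hs⟩ := this hBc hBn hAc hAn (le_of_not_ge h)
    exact ⟨-t, ⟨by linarith [ht.2], by linarith [ht.1]⟩, hs.neg⟩
  let F : ℝ → ℝ := fun t =>
    infDist (AffineMap.lineMap x (nearest A x) t) A - infDist (AffineMap.lineMap x (nearest A x) t) B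
  have hF : ContinuousOn F (Icc 0 1) := by
    have hl : Continuous fun t : ℝ => (AffineMap.lineMap x (nearest A x) t : Plane) :=
      AffineMap.lineMap_continuous
    exact (((continuous_infDist_pt A).comp hl).sub ((continuous_infDist_pt B).comp hl)).continuousOn
  have h0 : 0 ≤ F 0 := by simpa [F] using h
  have h1 : F 1 ≤ 0 := by
    simp only [F, AffineMap.lineMap_apply_one, infDist_zero_of_mem (nearest_spec hAc hAn x).1]
    linarith [infDist_nonneg (x := nearest A x) (s := B)]
  obtain ⟨t, ht, hFt⟩ := intermediate_value_Icc' zero_le_one hF ⟨h1, h0⟩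
  refine ⟨t, ⟨by linarith [ht.1], ht.2⟩, mul_nonneg ht.1 (sub_nonneg.2 h), ?_⟩
  rw [slide_of_nonneg _ _ _ ht.1]
  exact sub_eq_zero.1 hFt

/-- On the bisector the sign condition of `SlidesTo` is vacuous, so both directions must be
excluded: each ray starts on the bisector and cannot meet it again. -/
theorem SlidesTo.eq_zero {A B : Set Plane} (hAc : IsClosed A) (hAn : A.Nonempty)
    (hBc : IsClosed B) (hBn : B.Nonempty) (hAB : Disjoint A B) {x : Plane}
    (hx : x ∈ bisector A B) {t : ℝ} (ht : t ∈ Icc (-1 : ℝ) 1) (h : SlidesTo A B x t) : t = 0 := by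
  wlog h0 : 0 ≤ t generalizing A B t
  · have := this hBc hBn hAc hAn hAB.symm (bisector_comm A B ▸ hx) (t := -t)
      ⟨by linarith [ht.2], by linarith [ht.1]⟩ h.neg (by linarith)
    linarith
  have hb := h.2
  rw [slide_of_nonneg _ _ _ h0] at hb
  exact eq_of_lineMap_mem_bisector hBc hBn hAB (nearest_spec hAc hAn x).1
    (nearest_spec hAc hAn x).2 ⟨h0, ht.2⟩ ⟨le_rfl, zero_le_one⟩ hb (by simpa using hx)

theorem SlidesTo.unique {A B : Set Plane} (hAc : IsClosed A) (hAn : A.Nonempty)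
    (hBc : IsClosed B) (hBn : B.Nonempty) (hAB : Disjoint A B) {x : Plane} {s t : ℝ}
    (hs : s ∈ Icc (-1 : ℝ) 1) (ht : t ∈ Icc (-1 : ℝ) 1) (hxs : SlidesTo A B x s)
    (hxt : SlidesTo A B x t) : s = t := by
  by_cases hx : x ∈ bisector A B
  · rw [hxs.eq_zero hAc hAn hBc hBn hAB hx hs, hxt.eq_zero hAc hAn hBc hBn hAB hx ht]
  wlog h : infDist x B ≤ infDist x A generalizing A B s t
  · have := this hBc hBn hAc hAn hAB.symm (s := -s) (t := -t)
      ⟨by linarith [hs.2], by linarith [hs.1]⟩ ⟨by linarith [ht.2], by linarith [ht.1]⟩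
      hxs.neg hxt.neg (bisector_comm A B ▸ hx) (le_of_not_ge h)
    linarith
  have hlt : 0 < infDist x A - infDist x B := sub_pos.2 (lt_of_le_of_ne h fun e => hx e.symm)
  have h0s : 0 ≤ s := nonneg_of_mul_nonneg_left hxs.1 hlt
  have h0t : 0 ≤ t := nonneg_of_mul_nonneg_left hxt.1 hlt
  have hbs := hxs.2
  have hbt := hxt.2
  rw [slide_of_nonneg _ _ _ h0s] at hbs
  rw [slide_of_nonneg _ _ _ h0t] at hbt
  exact eq_of_lineMap_mem_bisector hBc hBn hAB (nearest_spec hAc hAn x).1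
    (nearest_spec hAc hAn x).2 ⟨h0s, hs.2⟩ ⟨h0t, ht.2⟩ hbs hbt

/-- A map into a compact space is continuous if its graph is closed. -/
theorem continuous_of_isClosed_graph {X Y : Type*} [TopologicalSpace X] [TopologicalSpace Y]
    [CompactSpace Y] {f : X → Y} (h : IsClosed {q : X × Y | f q.1 = q.2}) : Continuous f := by
  rw [continuous_iff_isClosed]
  intro s hs
  have : f ⁻¹' s = Prod.fst '' ({q : X × Y | f q.1 = q.2} ∩ Prod.snd ⁻¹' s) := by
    ext x
    constructor
    · intro hx
      exact ⟨(x, f x), ⟨rfl, hx⟩, rfl⟩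
    · rintro ⟨⟨x, y⟩, ⟨hxy, hy⟩, rfl⟩
      exact (show f x = y from hxy) ▸ hy
  rw [this]
  exact isClosedMap_fst_of_compactSpace _ (h.inter (hs.preimage continuous_snd))

/-- There is a retraction of the plane onto the bisector that does not increase the larger one of
the distances to the two sets. -/
theorem exists_retraction {A B : Set Plane} (hAc : IsClosed A) (hAn : A.Nonempty)
    (hA : Convex ℝ A) (hBc : IsClosed B) (hBn : B.Nonempty) (hB : Convex ℝ B)
    (hAB : Disjoint A B) :
    ∃ ρ : Plane → Plane, Continuous ρ ∧ (∀ x, ρ x ∈ bisector A B) ∧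
      (∀ x ∈ bisector A B, ρ x = x) ∧
      ∀ x, infDist (ρ x) A ≤ max (infDist x A) (infDist x B) := by
  choose σ hσ hs using exists_slidesTo hAc hAn hBc hBn
  let τ : Plane → Icc (-1 : ℝ) 1 := fun x => ⟨σ x, hσ x⟩
  have hslide : Continuous fun q : Plane × ℝ => slide A B q.1 q.2 := by
    have hA' := continuous_nearest hAc hAn hA
    have hB' := continuous_nearest hBc hBn hB
    unfold slide
    fun_prop
  -- By uniqueness the graph of `τ` is exactly the set cut out by the two closed conditions of
  -- `SlidesTo`, and the parameter interval is compact.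
  have hτ : Continuous τ := by
    apply continuous_of_isClosed_graph
    have : {q : Plane × Icc (-1 : ℝ) 1 | τ q.1 = q.2} =
        {q | 0 ≤ (q.2 : ℝ) * (infDist q.1 A - infDist q.1 B)} ∩
        {q | slide A B q.1 q.2 ∈ bisector A B} := by
      ext ⟨x, t, ht⟩
      simp only [mem_ofPred_eq, mem_inter_iff, τ, Subtype.mk.injEq]
      constructor
      · rintro rfl
        exact hs x
      · intro h
        exact SlidesTo.unique hAc hAn hBc hBn hAB (hσ x) ht (hs x) h
    rw [this]
    refine IsClosed.inter (isClosed_le continuous_const ?_) ((isClosed_bisector A B).preimage ?_)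
    · exact (continuous_subtype_val.comp continuous_snd).mul
        (((continuous_infDist_pt A).comp continuous_fst).sub
          ((continuous_infDist_pt B).comp continuous_fst))
    · exact hslide.comp (continuous_fst.prodMk (continuous_subtype_val.comp continuous_snd))
  refine ⟨fun x => slide A B x (σ x),
    hslide.comp (continuous_id.prodMk (continuous_subtype_val.comp hτ)), fun x => (hs x).2, ?_, ?_⟩
  · intro x hx
    simp only [(hs x).eq_zero hAc hAn hBc hBn hAB hx (hσ x), slide_zero]
  · intro x
    beta_reduce
    have hb : infDist (slide A B x (σ x)) A = infDist (slide A B x (σ x)) B := (hs x).2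
    rcases le_total 0 (σ x) with h | h
    · rw [slide_of_nonneg _ _ _ h, infDist_lineMap_nearest (nearest_spec hAc hAn x).1
        (nearest_spec hAc hAn x).2 ⟨h, (hσ x).2⟩]
      refine le_max_of_le_left ?_
      nlinarith [infDist_nonneg (x := x) (s := A)]
    · rw [hb, slide_of_nonpos _ _ _ h, infDist_lineMap_nearest (nearest_spec hBc hBn x).1
        (nearest_spec hBc hBn x).2 ⟨by linarith, by linarith [(hσ x).1]⟩]
      refine le_max_of_le_right ?_
      nlinarith [infDist_nonneg (x := x) (s := B)]

/-- Two points of the bisector are joined by a path in it on which the distance to the two sets is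
at most the larger one of the distances at the ends. -/
theorem exists_path_bisector {A B : Set Plane} (hAc : IsClosed A) (hAn : A.Nonempty)
    (hA : Convex ℝ A) (hBc : IsClosed B) (hBn : B.Nonempty) (hB : Convex ℝ B)
    (hAB : Disjoint A B) {x y : Plane} (hx : x ∈ bisector A B) (hy : y ∈ bisector A B)
    (hyx : infDist y A ≤ infDist x A) :
    ∃ γ : ℝ → Plane, Continuous γ ∧ γ 0 = x ∧ γ 1 = y ∧
      ∀ t ∈ Icc (0 : ℝ) 1, γ t ∈ bisector A B ∧ infDist (γ t) A ≤ infDist x A := by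
  obtain ⟨ρ, hρ, hmem, hfix, hle⟩ := exists_retraction hAc hAn hA hBc hBn hB hAB
  refine ⟨fun t => ρ (AffineMap.lineMap x y t), hρ.comp AffineMap.lineMap_continuous,
    by simpa using hfix x hx, by simpa using hfix y hy, fun t ht => ⟨hmem _, (hle _).trans ?_⟩⟩
  have h1 := infDist_lineMap_le hAc hAn hA x y ht
  have h2 := infDist_lineMap_le hBc hBn hB x y ht
  rw [← mem_bisector.1 hx, ← mem_bisector.1 hy] at h2
  have h3 : (1 - t) * infDist x A + t * infDist y A ≤ infDist x A := by
    nlinarith [ht.1]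
  exact max_le (h1.trans h3) (h2.trans h3)

/-! ### The critical points of a bisector -/

variable {n c : ℕ} {C : Fin n → Set Plane}

/-- The midpoint of a closest pair works: everywhere the two distances add up to at least the length
of that pair, and at the midpoint each is at most half of it. -/
theorem exists_isDistMin_bisector {A B : Set Plane}
    (h : ∃ x ∈ A, ∃ y ∈ B, ∀ x' ∈ A, ∀ y' ∈ B, dist x y ≤ dist x' y') (hAc : IsClosed A)
    (hBc : IsClosed B) : ∃ p, IsDistMin A (bisector A B) p := by
  obtain ⟨x, hx, y, hy, hxy⟩ := h
  have hsum : ∀ q, dist x y ≤ infDist q A + infDist q B := by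
    intro q
    obtain ⟨a, ha, hqa⟩ := hAc.exists_infDist_eq_dist ⟨x, hx⟩ q
    obtain ⟨b, hb, hqb⟩ := hBc.exists_infDist_eq_dist ⟨y, hy⟩ q
    rw [hqa, hqb, dist_comm q a]
    exact (hxy a ha b hb).trans (dist_triangle a q b)
  have hmA : infDist (midpoint ℝ x y) A ≤ dist x y / 2 := by
    refine (infDist_le_dist_of_mem hx).trans_eq ?_
    rw [dist_midpoint_left, Real.norm_of_nonneg zero_le_two]
    ring
  have hmB : infDist (midpoint ℝ x y) B ≤ dist x y / 2 := by
    refine (infDist_le_dist_of_mem hy).trans_eq ?_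
    rw [dist_midpoint_right, Real.norm_of_nonneg zero_le_two]
    ring
  have hm := hsum (midpoint ℝ x y)
  refine ⟨midpoint ℝ x y, ?_, fun q hq => ?_⟩
  · rw [mem_bisector]
    linarith
  · have := hsum q
    rw [← mem_bisector.1 hq] at this
    linarith

theorem bisectorMin_spec (hC : IsInput c C) (i j : Fin n) :
    IsDistMin (C i) (bisector (C i) (C j)) (bisectorMin (C i) (C j)) :=
  Classical.epsilon_spec (p := fun p => IsDistMin (C i) (bisector (C i) (C j)) p)
    (exists_isDistMin_bisector (hC.attained i j) (hC.closed i) (hC.closed j))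

theorem tiePoints_comm (C : Fin n → Set Plane) (i j : Fin n) :
    tiePoints C i j = tiePoints C j i := by
  have h : ∀ i j, tiePoints C i j ⊆ tiePoints C j i := by
    rintro i j p ⟨l, hli, hlj, h1, h2⟩
    exact ⟨l, hlj, hli, h1.symm, (h1.symm.trans h2 :)⟩
  exact (h i j).antisymm (h j i)

theorem tiePoints_subset_bisector (C : Fin n → Set Plane) (i j : Fin n) :
    tiePoints C i j ⊆ bisector (C i) (C j) := by
  rintro p ⟨l, -, -, h, -⟩
  exact h

theorem IsInput.finite_equidistantPoints (hC : IsInput c C) {i j l : Fin n} (hij : i ≠ j)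
    (hil : i ≠ l) (hjl : j ≠ l) : (equidistantPoints (C i) (C j) (C l)).Finite :=
  finite_of_encard_le_coe (hC.meet i j l hij hil hjl)

theorem IsInput.finite_tiePoints (hC : IsInput c C) {i j : Fin n} (hij : i ≠ j) :
    (tiePoints C i j).Finite := by
  refine (finite_iUnion fun l : {l // l ≠ i ∧ l ≠ j} =>
    hC.finite_equidistantPoints hij l.2.1.symm l.2.2.symm).subset ?_
  rintro p ⟨l, hli, hlj, h⟩
  exact mem_iUnion.2 ⟨⟨l, hli, hlj⟩, h⟩

theorem isArc_comm {i j : Fin n} {A : Set Plane} : IsArc C i j A ↔ IsArc C j i A := by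
  rw [IsArc, IsArc, bisector_comm, tiePoints_comm]

theorem IsArc.subset_bisector {i j : Fin n} {A : Set Plane} (h : IsArc C i j A) :
    A ⊆ bisector (C i) (C j) := by
  obtain ⟨x, -, rfl⟩ := h
  exact closure_minimal ((connectedComponentIn_subset _ _).trans sdiff_subset)
    (isClosed_bisector _ _)

/-- Needed because each unordered pair is processed in one order only, while arcs are considered for
both. -/
theorem IsDistMin.congr {A B K : Set Plane} {p : Plane} (hK : K ⊆ bisector A B)
    (h : IsDistMin A K p) : IsDistMin B K p :=
  ⟨h.1, fun q hq => by rw [← mem_bisector.1 (hK h.1), ← mem_bisector.1 (hK hq)]; exact h.2 q hq⟩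

/-- The points of a bisector that are output: a point of minimum distance, and the points that are
equidistant to a third object. -/
def criticalPoints (C : Fin n → Set Plane) (i j : Fin n) : Set Plane :=
  insert (bisectorMin (C i) (C j)) (tiePoints C i j)

theorem IsInput.finite_criticalPoints (hC : IsInput c C) {i j : Fin n} (hij : i ≠ j) :
    (criticalPoints C i j).Finite :=
  (hC.finite_tiePoints hij).insert _

theorem isBisectorCandidate_of_mem_criticalPoints (hC : IsInput c C) {i j : Fin n} {p : Plane}
    (hp : p ∈ criticalPoints C i j) : IsBisectorCandidate C i j p := by
  by_cases h : p ∈ tiePoints C i j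
  · exact Or.inl h
  obtain rfl := hp.resolve_right h
  have hm := bisectorMin_spec hC i j
  have hA : IsArc C i j _ := ⟨_, ⟨hm.1, h⟩, rfl⟩
  exact Or.inr ⟨_, hA, subset_closure (mem_connectedComponentIn ⟨hm.1, h⟩),
    fun q hq => hm.2 q (hA.subset_bisector hq)⟩

/-- A path that starts in `F \ T` and leaves the component of its starting point in `F \ T` meets
`T` in the closure of this component. -/
theorem exists_mem_closure_component {X : Type*} [TopologicalSpace X] {F T : Set X}
    (hT : IsClosed T) {γ : ℝ → X} (hγ : Continuous γ) (hF : ∀ t ∈ Icc (0 : ℝ) 1, γ t ∈ F)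
    (h0 : γ 0 ∉ T) :
    ∃ t ∈ Icc (0 : ℝ) 1, γ t ∈ closure (connectedComponentIn (F \ T) (γ 0)) ∧
      (t = 1 ∨ γ t ∈ T) := by
  -- The infimum of `Z` is the first time in `T`. Before it the path is a connected subset of `F \
  -- T`, so it stays in the component, and its limit lies in the closure.
  set Z : Set ℝ := Icc 0 1 ∩ γ ⁻¹' T with hZ
  have hinit : ∀ t ∈ Icc (0 : ℝ) 1, (∀ s ∈ Ico 0 t, γ s ∉ T) → ∀ s ∈ Ico 0 t,
      γ s ∈ connectedComponentIn (F \ T) (γ 0) := by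
    intro t ht h s hs
    have hc : IsPreconnected (γ '' Icc 0 s) := isPreconnected_Icc.image _ hγ.continuousOn
    refine hc.subset_connectedComponentIn ⟨0, ⟨le_rfl, hs.1⟩, rfl⟩ ?_ ⟨s, ⟨hs.1, le_rfl⟩, rfl⟩
    rintro _ ⟨u, hu, rfl⟩
    exact ⟨hF u ⟨hu.1, hu.2.trans (hs.2.le.trans ht.2)⟩, h u ⟨hu.1, hu.2.trans_lt hs.2⟩⟩
  have hclos : ∀ t ∈ Ioc (0 : ℝ) 1, (∀ s ∈ Ico 0 t, γ s ∉ T) →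
      γ t ∈ closure (connectedComponentIn (F \ T) (γ 0)) := by
    intro t ht h
    refine map_mem_closure hγ (s := Ico 0 t) ?_ (hinit t ⟨ht.1.le, ht.2⟩ h)
    rw [closure_Ico ht.1.ne]
    exact ⟨ht.1.le, le_rfl⟩
  by_cases hne : Z.Nonempty
  · have hZc : IsClosed Z := isClosed_Icc.inter (hT.preimage hγ)
    have hbd : BddBelow Z := ⟨0, fun t ht => ht.1.1⟩
    have hmem := hZc.csInf_mem hne hbd
    have hpos : 0 < sInf Z := lt_of_le_of_ne hmem.1.1 fun e => h0 (by rw [e]; exact hmem.2)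
    refine ⟨sInf Z, hmem.1, hclos _ ⟨hpos, hmem.1.2⟩ fun s hs hsT => ?_, Or.inr hmem.2⟩
    exact hs.2.not_ge (csInf_le hbd ⟨⟨hs.1, hs.2.le.trans hmem.1.2⟩, hsT⟩)
  · refine ⟨1, ⟨zero_le_one, le_rfl⟩, hclos 1 ⟨one_pos, le_rfl⟩ fun s hs hsT => hne ?_, Or.inl rfl⟩
    exact ⟨s, ⟨hs.1, hs.2.le⟩, hsT⟩

/-- Follow the path from `x` to the global minimum of the bisector and stop at the first tie, if
there is one. -/
theorem exists_criticalPoint_le (hC : IsInput c C) {i j : Fin n} (hij : i ≠ j) {x : Plane}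
    (hx : x ∈ bisector (C i) (C j) \ tiePoints C i j) :
    ∃ y ∈ closure (connectedComponentIn (bisector (C i) (C j) \ tiePoints C i j) x),
      y ∈ criticalPoints C i j ∧ infDist y (C i) ≤ infDist x (C i) := by
  have hm := bisectorMin_spec hC i j
  obtain ⟨γ, hγ, h0, h1, h⟩ := exists_path_bisector (hC.closed i) (hC.nonempty i) (hC.convex i)
    (hC.closed j) (hC.nonempty j) (hC.convex j) (hC.disjoint i j hij) hx.1 hm.1 (hm.2 x hx.1)
  obtain ⟨t, ht, htc, htT⟩ := exists_mem_closure_component (hC.finite_tiePoints hij).isClosed hγ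
    (fun t ht => (h t ht).1) (h0 ▸ hx.2)
  refine ⟨γ t, h0 ▸ htc, ?_, (h t ht).2⟩
  rcases htT with rfl | hT
  · exact Or.inl h1
  · exact Or.inr hT

/-- Every arc has a point of minimum distance among the critical points. -/
theorem IsArc.exists_isDistMin (hC : IsInput c C) {i j : Fin n} (hij : i ≠ j) {A : Set Plane}
    (hA : IsArc C i j A) : ∃ p ∈ criticalPoints C i j, IsDistMin (C i) A p := by
  obtain ⟨x, hx, rfl⟩ := hA
  set K := connectedComponentIn (bisector (C i) (C j) \ tiePoints C i j) x with hK
  have hfin : (closure K ∩ criticalPoints C i j).Finite :=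
    (hC.finite_criticalPoints hij).inter_of_right _
  have hne : (closure K ∩ criticalPoints C i j).Nonempty := by
    obtain ⟨y, hy, hyc, -⟩ := exists_criticalPoint_le hC hij hx
    exact ⟨y, hy, hyc⟩
  obtain ⟨p, hp, hmin⟩ := exists_min_image _ (fun p => infDist p (C i)) hfin hne
  refine ⟨p, hp.2, hp.1, fun q hq => ?_⟩
  -- The best of the finitely many critical points on the closed arc beats every point of `K`, since
  -- each is dominated by a critical point.
  have hsub : K ⊆ {q | infDist p (C i) ≤ infDist q (C i)} := by
    intro q hq
    obtain ⟨y, hy, hyc, hyq⟩ :=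
      exists_criticalPoint_le hC hij (connectedComponentIn_subset _ _ hq)
    rw [← connectedComponentIn_eq hq] at hy
    exact (hmin y ⟨hy, hyc⟩).trans hyq
  exact closure_minimal hsub (isClosed_le continuous_const (continuous_infDist_pt _)) hq

/-- On an arc, no object that is closer than `C i` somewhere is farther than `C i` elsewhere. -/
theorem infDist_le_on_arc {i j l : Fin n} {x : Plane}
    (hx : x ∈ bisector (C i) (C j) \ tiePoints C i j)
    (hl : infDist x (C l) ≤ infDist x (C i)) {p : Plane}
    (hp : p ∈ closure (connectedComponentIn (bisector (C i) (C j) \ tiePoints C i j) x)) :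
    infDist p (C l) ≤ infDist p (C i) := by
  set K := connectedComponentIn (bisector (C i) (C j) \ tiePoints C i j) x with hK
  have hKs : K ⊆ bisector (C i) (C j) \ tiePoints C i j := connectedComponentIn_subset _ _
  rcases eq_or_ne l i with rfl | hli
  · exact le_rfl
  suffices h : K ⊆ {q | infDist q (C l) ≤ infDist q (C i)} from
    closure_minimal h (isClosed_le (continuous_infDist_pt _) (continuous_infDist_pt _)) hp
  rcases eq_or_ne l j with rfl | hlj
  · intro q hq
    exact (hKs hq).1.ge
  intro q hq
  by_contra hlt
  have hc : IsPreconnected K := isPreconnected_connectedComponentIn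
  obtain ⟨y, hy, hye⟩ := hc.intermediate_value₂ (mem_connectedComponentIn hx) hq
    (continuous_infDist_pt (C l)).continuousOn (continuous_infDist_pt (C i)).continuousOn hl
    (not_le.1 hlt).le
  exact (hKs hy).2 ⟨l, hli, hlj, (hKs hy).1, hye.symm⟩

/-! ### Optimal centers -/

/-- A center can be moved to a point that is equidistant to two of its objects, and not closer to
any other one. -/
theorem exists_equidistant_of_two_le (hC : IsInput c C) (I : Finset (Fin n)) (hI : 1 < I.card)
    (s : Plane) {r : ℝ} (hs : ∀ i ∈ I, infDist s (C i) ≤ r) :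
    ∃ i ∈ I, ∃ j ∈ I, i ≠ j ∧ ∃ x ∈ bisector (C i) (C j), infDist x (C i) ≤ r ∧
      ∀ l ∈ I, infDist x (C l) ≤ infDist x (C i) := by
  obtain ⟨i, hi, hmax⟩ := I.exists_max_image (fun i => infDist s (C i))
    (Finset.card_pos.1 (by omega))
  have hne : (I.erase i).Nonempty := Finset.card_pos.1 (by rw [Finset.card_erase_of_mem hi]; omega)
  obtain ⟨a, ha, hsa⟩ := (hC.closed i).exists_infDist_eq_dist (hC.nonempty i) s
  -- On the way to `a`, the distance to the farthest of the other objects starts below the distance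
  -- to `C i` and ends above it. Where they agree, a maximizer serves as `j`.
  let G : Plane → ℝ := fun x => (I.erase i).sup' hne fun j => infDist x (C j)
  have hG : Continuous G :=
    Continuous.finset_sup'_apply hne fun j _ => continuous_infDist_pt (C j)
  have hl : Continuous fun t : ℝ => (AffineMap.lineMap s a t : Plane) :=
    AffineMap.lineMap_continuous
  obtain ⟨t, ht, hte⟩ := isPreconnected_Icc.intermediate_value₂ (a := (0 : ℝ)) (b := 1)
    (s := Icc (0 : ℝ) 1) ⟨le_rfl, zero_le_one⟩ ⟨zero_le_one, le_rfl⟩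
    (hG.comp hl).continuousOn ((continuous_infDist_pt (C i)).comp hl).continuousOn
    (by
      simp only [Function.comp_apply, AffineMap.lineMap_apply_zero]
      exact Finset.sup'_le _ _ fun j hj => hmax j (Finset.mem_of_mem_erase hj))
    (by
      simp only [Function.comp_apply, AffineMap.lineMap_apply_one, infDist_zero_of_mem ha]
      obtain ⟨j, hj⟩ := hne
      exact infDist_nonneg.trans (Finset.le_sup' (fun j => infDist a (C j)) hj))
  simp only [Function.comp_apply] at hte
  obtain ⟨j, hj, hje⟩ := Finset.exists_mem_eq_sup' hne
    fun j => infDist (AffineMap.lineMap s a t : Plane) (C j)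
  refine ⟨i, hi, j, Finset.mem_of_mem_erase hj, (Finset.ne_of_mem_erase hj).symm,
    AffineMap.lineMap s a t, hte.symm.trans hje, ?_, fun l hl => ?_⟩
  · rw [infDist_lineMap_nearest ha hsa ht]
    refine le_trans ?_ (hs i hi)
    nlinarith [infDist_nonneg (x := s) (s := C i), ht.1]
  · rcases eq_or_ne l i with rfl | hli
    · exact le_rfl
    · rw [← hte]
      exact Finset.le_sup' (fun j => infDist (AffineMap.lineMap s a t : Plane) (C j))
        (Finset.mem_erase.2 ⟨hli, hl⟩)

/-- The points that are output. -/
def candidatePoints (C : Fin n → Set Plane) : Set Plane :=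
  {p | ∃ i, p = somePoint (C i) ∨ ∃ j, j < i ∧ p ∈ criticalPoints C i j}

/-- The radii that are output. -/
def candidateRadii (C : Fin n → Set Plane) : Set ℝ :=
  {r | r = 0 ∨ ∃ i j, j < i ∧ ∃ p ∈ criticalPoints C i j, r = infDist p (C i)}

theorem somePoint_mem (hC : IsInput c C) (i : Fin n) : somePoint (C i) ∈ C i :=
  Classical.epsilon_spec (hC.nonempty i)

theorem exists_candidate (hn : 1 ≤ n) (hC : IsInput c C) (I : Finset (Fin n)) (s : Plane) {r : ℝ}
    (hr : 0 ≤ r) (hs : ∀ i ∈ I, infDist s (C i) ≤ r) :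
    ∃ p ∈ candidatePoints C, ∃ v ∈ candidateRadii C, 0 ≤ v ∧ v ≤ r ∧
      ∀ i ∈ I, infDist p (C i) ≤ v := by
  rcases Nat.lt_or_ge 1 I.card with hI | hI
  -- The pair is put in decreasing order because only such pairs contribute candidates.
  · have key : ∃ i ∈ I, ∃ j ∈ I, j < i ∧ ∃ x ∈ bisector (C i) (C j), infDist x (C i) ≤ r ∧
        ∀ l ∈ I, infDist x (C l) ≤ infDist x (C i) := by
      obtain ⟨i, hi, j, hj, hij, x, hx, hxr, hxI⟩ := exists_equidistant_of_two_le hC I hI s hs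
      rcases lt_or_gt_of_ne hij with h | h
      · refine ⟨j, hj, i, hi, h, x, hx.symm, ?_, ?_⟩ <;> rw [← mem_bisector.1 hx]
        exacts [hxr, hxI]
      · exact ⟨i, hi, j, hj, h, x, hx, hxr, hxI⟩
    obtain ⟨i, hi, j, hj, hji, x, hx, hxr, hxI⟩ := key
    have main : ∃ p ∈ criticalPoints C i j, infDist p (C i) ≤ r ∧
        ∀ l ∈ I, infDist p (C l) ≤ infDist p (C i) := by
      by_cases hxT : x ∈ tiePoints C i j
      · exact ⟨x, Or.inr hxT, hxr, hxI⟩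
      have hA : IsArc C i j _ := ⟨x, ⟨hx, hxT⟩, rfl⟩
      obtain ⟨p, hp, hpm⟩ := hA.exists_isDistMin hC hji.ne'
      refine ⟨p, hp, (hpm.2 x (subset_closure (mem_connectedComponentIn ⟨hx, hxT⟩))).trans hxr,
        fun l hl => infDist_le_on_arc ⟨hx, hxT⟩ (hxI l hl) hpm.1⟩
    obtain ⟨p, hp, hpr, hpI⟩ := main
    exact ⟨p, ⟨i, Or.inr ⟨j, hji, hp⟩⟩, _, Or.inr ⟨i, j, hji, p, hp, rfl⟩, infDist_nonneg, hpr,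
      hpI⟩
  · have : Nonempty (Fin n) := ⟨⟨0, hn⟩⟩
    obtain ⟨i, hi⟩ := Finset.card_le_one_iff_subset_singleton.1 hI
    refine ⟨_, ⟨i, Or.inl rfl⟩, 0, Or.inl rfl, le_rfl, hr, fun l hl => ?_⟩
    rw [Finset.mem_singleton.1 (hi hl), infDist_zero_of_mem (somePoint_mem hC i)]

theorem radius_le_iff (hC : IsInput c C) (S : Finset Plane) {r : ℝ} (hr : 0 ≤ r) :
    radius C S ≤ ENNReal.ofReal r ↔ ∀ i, ∃ s ∈ S, infDist s (C i) ≤ r := by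
  have e : ∀ s i, infEDist s (C i) ≤ ENNReal.ofReal r ↔ infDist s (C i) ≤ r := fun s i => by
    rw [infDist, ENNReal.le_ofReal_iff_toReal_le (infEDist_ne_top (hC.nonempty i)) hr]
  simp only [radius, iSup_le_iff, ← Finset.inf_eq_iInf, Finset.inf_le_iff ENNReal.ofReal_lt_top, e]

theorem radius_ne_top (hC : IsInput c C) {S : Finset Plane} (hS : S.Nonempty) :
    radius C S ≠ ⊤ := by
  obtain ⟨s, hs⟩ := hS
  refine ne_top_of_le_ne_top (b := ENNReal.ofReal (∑ i, infDist s (C i))) ENNReal.ofReal_ne_top ?_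
  refine (radius_le_iff hC S (Finset.sum_nonneg fun i _ => infDist_nonneg)).2 fun i => ⟨s, hs, ?_⟩
  exact Finset.single_le_sum (f := fun i => infDist s (C i)) (fun i _ => infDist_nonneg)
    (Finset.mem_univ i)

theorem radius_anti (C : Fin n → Set Plane) {S S' : Finset Plane} (h : S ⊆ S') :
    radius C S' ≤ radius C S :=
  iSup_mono fun _ => biInf_mono fun _ hs => h hs

/-- Every nonempty set of centers is matched by candidates, with one of the candidate radii. -/
theorem exists_candidates (hn : 1 ≤ n) (hC : IsInput c C) {S : Finset Plane} (hS : S.Nonempty) :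
    ∃ S' : Finset Plane, ↑S' ⊆ candidatePoints C ∧ S'.card ≤ S.card ∧
      ∃ v ∈ candidateRadii C, v ≤ (radius C S).toReal ∧ radius C S' ≤ ENNReal.ofReal v := by
  classical
  set r := (radius C S).toReal with hr
  have hr0 : 0 ≤ r := ENNReal.toReal_nonneg
  have hcov := (radius_le_iff hC S hr0).1 (by rw [hr, ENNReal.ofReal_toReal (radius_ne_top hC hS)])
  choose p hp v hv hv0 hvr hpv using fun s : Plane =>
    exists_candidate hn hC (Finset.univ.filter fun i => infDist s (C i) ≤ r) s hr0
      fun i hi => (Finset.mem_filter.1 hi).2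
  obtain ⟨s₀, hs₀, hmax⟩ := S.exists_max_image v hS
  -- The largest of the individual radii bounds all of them and is itself a candidate radius.
  refine ⟨S.image p, ?_, Finset.card_image_le, v s₀, hv s₀, hvr s₀,
    (radius_le_iff hC _ (hv0 s₀)).2 fun i => ?_⟩
  · intro q hq
    obtain ⟨s, -, rfl⟩ := Finset.mem_image.1 hq
    exact hp s
  · obtain ⟨s, hs, hsi⟩ := hcov i
    exact ⟨p s, Finset.mem_image_of_mem p hs,
      (hpv s i (Finset.mem_filter.2 ⟨Finset.mem_univ i, hsi⟩)).trans (hmax s hs)⟩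

/-- A best subset of `P` with at most `k` points is optimal by `exists_candidates`. Adding centers
never increases the radius, so it can be padded to the exact cardinality. -/
theorem exists_isOptimal (hn : 1 ≤ n) (hC : IsInput c C) {P : Finset Plane}
    (hP : (P : Set Plane) = candidatePoints C) (k : ℕ) :
    ∃ S ⊆ P, S.card = min k P.card ∧ IsOptimal C k S ∧
      (1 ≤ k → radius C S ≠ ⊤ ∧ (radius C S).toReal ∈ candidateRadii C) := by
  classical
  have hmatch : ∀ S' : Finset Plane, S'.card ≤ k → ∃ S'' ⊆ P, S''.card ≤ k ∧
      radius C S'' ≤ radius C S' := by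
    intro S' hS'
    rcases S'.eq_empty_or_nonempty with rfl | hne
    · exact ⟨∅, Finset.empty_subset _, by simp, le_rfl⟩
    obtain ⟨S'', hsub, hcard, v, -, hvr, hle⟩ := exists_candidates hn hC hne
    refine ⟨S'', by rwa [← Finset.coe_subset, hP], hcard.trans hS', hle.trans ?_⟩
    exact (ENNReal.ofReal_le_ofReal hvr).trans
      (ENNReal.ofReal_toReal (radius_ne_top hC hne)).le
  obtain ⟨S₀, hS₀, hmin⟩ := (P.powerset.filter fun S => S.card ≤ k).exists_min_image (radius C)
    ⟨∅, by simp⟩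
  rw [Finset.mem_filter, Finset.mem_powerset] at hS₀
  obtain ⟨S, hS₀S, hSP, hcard⟩ := Finset.exists_subsuperset_card_eq hS₀.1
    (le_min hS₀.2 (Finset.card_le_card hS₀.1)) (min_le_right k P.card)
  have hopt : IsOptimal C k S := by
    refine ⟨hcard.trans_le (min_le_left _ _), fun S' hS' => ?_⟩
    obtain ⟨S'', hsub, hc, hle⟩ := hmatch S' hS'
    exact (radius_anti C hS₀S).trans ((hmin S''
      (Finset.mem_filter.2 ⟨Finset.mem_powerset.2 hsub, hc⟩)).trans hle)
  refine ⟨S, hSP, hcard, hopt, fun hk => ?_⟩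
  have hPne : P.Nonempty := by
    rw [← Finset.coe_nonempty, hP]
    exact ⟨_, ⟨⟨0, hn⟩, Or.inl rfl⟩⟩
  have hne : S.Nonempty := by
    rw [← Finset.card_pos, hcard]
    exact lt_min hk hPne.card_pos
  refine ⟨radius_ne_top hC hne, ?_⟩
  obtain ⟨S', -, hc, v, hv, hvr, hle⟩ := exists_candidates hn hC hne
  have h0v : 0 ≤ v := by
    rcases hv with rfl | ⟨i, j, -, p, -, rfl⟩
    exacts [le_rfl, infDist_nonneg]
  -- Optimality of `S` gives the reverse of `hvr`, so the radius equals the candidate value `v`.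
  have h1 := (hopt.2 S' (hc.trans hopt.1)).trans hle
  have h2 := ENNReal.toReal_le_of_le_ofReal h0v h1
  rwa [le_antisymm h2 hvr]

/-! ### The properties of the candidates -/

theorem candidatePoints_kinds (hC : IsInput c C) {p : Plane} (hp : p ∈ candidatePoints C) :
    (∃ i, p ∈ C i) ∨ ∃ i j, i ≠ j ∧ IsBisectorCandidate C i j p := by
  obtain ⟨i, rfl | ⟨j, hji, hp⟩⟩ := hp
  · exact Or.inl ⟨i, somePoint_mem hC i⟩
  · exact Or.inr ⟨i, j, hji.ne', isBisectorCandidate_of_mem_criticalPoints hC hp⟩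

theorem candidateRadii_kinds (hC : IsInput c C) {r : ℝ} (hr : r ∈ candidateRadii C) :
    r = 0 ∨ ∃ i j, i ≠ j ∧ ∃ p ∈ candidatePoints C,
      IsBisectorCandidate C i j p ∧ r = infDist p (C i) := by
  obtain rfl | ⟨i, j, hji, p, hp, rfl⟩ := hr
  · exact Or.inl rfl
  · exact Or.inr ⟨i, j, hji.ne', p, ⟨i, Or.inr ⟨j, hji, hp⟩⟩,
      isBisectorCandidate_of_mem_criticalPoints hC hp, rfl⟩

theorem tiePoints_subset_candidatePoints {i j : Fin n} (hij : i ≠ j) :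
    tiePoints C i j ⊆ candidatePoints C := by
  intro p hp
  rcases lt_or_gt_of_ne hij with h | h
  · exact ⟨j, Or.inr ⟨i, h, Or.inr (tiePoints_comm C i j ▸ hp)⟩⟩
  · exact ⟨i, Or.inr ⟨j, h, Or.inr hp⟩⟩

theorem IsArc.exists_candidate (hC : IsInput c C) {i j : Fin n} (hij : i ≠ j) {A : Set Plane}
    (hA : IsArc C i j A) : ∃ p ∈ candidatePoints C, IsDistMin (C i) A p := by
  rcases lt_or_gt_of_ne hij with h | h
  · have hA' := isArc_comm.1 hA
    obtain ⟨p, hp, hm⟩ := hA'.exists_isDistMin hC h.ne'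
    exact ⟨p, ⟨j, Or.inr ⟨i, h, hp⟩⟩, hm.congr hA'.subset_bisector⟩
  · obtain ⟨p, hp, hm⟩ := hA.exists_isDistMin hC h.ne'
    exact ⟨p, ⟨i, Or.inr ⟨j, h, hp⟩⟩, hm⟩

/-- The loops visit only triples with decreasing indices, so a tie on a given bisector may be output
under another pair. The last equation shows that its radius is the same there. -/
theorem exists_sorted_of_mem_tiePoints {i j : Fin n} (hij : i ≠ j) {p : Plane}
    (hp : p ∈ tiePoints C i j) : ∃ a b l, l < b ∧ b < a ∧
      p ∈ equidistantPoints (C a) (C b) (C l) ∧ infDist p (C a) = infDist p (C i) := by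
  obtain ⟨l, hli, hlj, h1, h2⟩ := hp
  rw [mem_bisector] at h1 h2
  have key : ∀ a b d : Fin n, infDist p (C a) = infDist p (C i) →
      infDist p (C b) = infDist p (C i) → infDist p (C d) = infDist p (C i) → d < b → b < a →
      ∃ a b l, l < b ∧ b < a ∧
      p ∈ equidistantPoints (C a) (C b) (C l) ∧ infDist p (C a) = infDist p (C i) :=
    fun a b d ha hb hd hdb hba => ⟨a, b, d, hdb, hba, ⟨ha.trans hb.symm, ha.trans hd.symm⟩, ha⟩
  rcases lt_or_gt_of_ne hij with h | h <;> rcases lt_or_gt_of_ne hli with h' | h' <;>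
    rcases lt_or_gt_of_ne hlj with h'' | h''
  · exact key j i l h1.symm rfl h2.symm h' h
  · exact key j i l h1.symm rfl h2.symm h' h
  · exact key j l i h1.symm h2.symm rfl h' h''
  · exact key l j i h2.symm h1.symm rfl h h''
  · exact key i j l rfl h1.symm h2.symm h'' h
  · exact key i l j rfl h2.symm h1.symm h'' h'
  · exact key l i j h2.symm rfl h1.symm h h'
  · exact key l i j h2.symm rfl h1.symm h h'

/-! ### Running programs -/

section Programs

variable {n : ℕ} {C : Fin n → Set Plane}

/-- Started in `s`, the program `p` halts after at most `B` steps, does not change the first `m`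
numbers, and outputs the points `X` and the radii `Y`. -/
def Emits (C : Fin n → Set Plane) (p : Program) (s : State) (B m : ℕ) (X : Set Plane)
    (Y : Set ℝ) : Prop :=
  ∃ s' t, Run C p s s' t ∧ t ≤ B ∧ (∀ a < m, s'.num a = s.num a) ∧
    (∀ q, q ∈ s'.outPts ↔ q ∈ s.outPts ∨ q ∈ X) ∧
    ∀ r, r ∈ s'.outRadii ↔ r ∈ s.outRadii ∨ r ∈ Y

theorem Emits.mono {p : Program} {s : State} {B B' m m' : ℕ} {X : Set Plane} {Y : Set ℝ}
    (h : Emits C p s B m X Y) (hB : B ≤ B') (hm : m' ≤ m) : Emits C p s B' m' X Y := by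
  obtain ⟨s', t, hr, ht, hnum, hX, hY⟩ := h
  exact ⟨s', t, hr, ht.trans hB, fun a ha => hnum a (ha.trans_le hm), hX, hY⟩

/-- The continuation may rely only on the first `m` number cells. This is how inner loops keep the
constants and the outer counters, which sit in lower cells. -/
theorem Emits.seq {p q : Program} {s : State} {B B' m m' : ℕ} {X X' : Set Plane} {Y Y' : Set ℝ}
    (hp : Emits C p s B m X Y) (hm : m' ≤ m)
    (hq : ∀ s', (∀ a < m, s'.num a = s.num a) → Emits C q s' B' m' X' Y') :
    Emits C (.seq p q) s (B + B') m' (X ∪ X') (Y ∪ Y') := by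
  obtain ⟨s', t, hr, ht, hnum, hX, hY⟩ := hp
  obtain ⟨s'', t', hr', ht', hnum', hX', hY'⟩ := hq s' hnum
  refine ⟨s'', t + t', hr.seq hr', Nat.add_le_add ht ht',
    fun a ha => (hnum' a ha).trans (hnum a (ha.trans_le hm)), fun x => ?_, fun r => ?_⟩
  · rw [hX', hX, mem_union, or_assoc]
  · rw [hY', hY, mem_union, or_assoc]

theorem Emits.instr_seq {o : Instr} {q : Program} {s : State} {B m : ℕ} {X : Set Plane}
    {Y : Set ℝ} (hq : Emits C q (o.apply C s) B m X Y)
    (hnum : ∀ a < m, (o.apply C s).num a = s.num a) (hP : (o.apply C s).outPts = s.outPts)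
    (hR : (o.apply C s).outRadii = s.outRadii) :
    Emits C (.seq (.instr o) q) s (B + 1) m X Y := by
  obtain ⟨s', t, hr, ht, hn, hX, hY⟩ := hq
  refine ⟨s', 1 + t, (Run.instr o s).seq hr, by omega, fun a ha => (hn a ha).trans (hnum a ha),
    fun q => ?_, fun r => ?_⟩
  · rw [hX, hP]
  · rw [hY, hR]

/-- Output a point and its distance to an object. -/
def emitWithRadius (o : Addr) : Program :=
  .seq (.instr (.outPt (.cell 0))) (.seq (.instr (.distance (.cell 0) (.cell 0) o))
    (.instr (.outRadius (.cell 0))))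

theorem emits_outPt (s : State) (m : ℕ) :
    Emits C (.instr (.outPt (.cell 0))) s 1 m {s.pt 0} ∅ := by
  refine ⟨_, 1, Run.instr _ s, le_rfl, fun a _ => rfl, fun q => ?_, fun r => ?_⟩
  · simp [Instr.apply, State.getPt, State.loc, or_comm]
  · simp [Instr.apply]

theorem emits_outRadius (s : State) (m : ℕ) :
    Emits C (.instr (.outRadius (.cell 0))) s 1 m ∅ {s.real 0} := by
  refine ⟨_, 1, Run.instr _ s, le_rfl, fun a _ => rfl, fun q => ?_, fun r => ?_⟩
  · simp [Instr.apply]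
  · simp [Instr.apply, State.getReal, State.loc, or_comm]

theorem emits_emitWithRadius (o : ℕ) (s : State) (m : ℕ) :
    Emits C (emitWithRadius (.cell o)) s 3 m {s.pt 0}
      {infDist (s.pt 0) (object C (s.num o))} := by
  refine ⟨_, 1 + (1 + 1), (Run.instr _ s).seq ((Run.instr _ _).seq (Run.instr _ _)), le_rfl,
    fun a _ => rfl, fun q => ?_, fun r => ?_⟩
  · simp [Instr.apply, State.getPt, State.putReal, State.loc, or_comm]
  · simp [Instr.apply, State.getPt, State.getReal, State.getNum, State.putReal, State.loc, or_comm]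

/-- Run `p` with the values `v - 1, …, 0` in cell `a`, where `v` is the initial value; cells 1
and 2 have to hold 1 and 0. -/
def countdown (a : ℕ) (p : Program) : Program :=
  .loop (.numLt (.cell 2) (.cell a)) (.seq (.instr (.subNum (.cell a) (.cell a) (.cell 1))) p)

/-- Each pass costs the body plus a test and a decrement, and the failing test adds 1. The body must
also preserve cell `a`, whence `a + 1`. -/
theorem emits_countdown {a : ℕ} (ha : 3 ≤ a) {p : Program} {B : ℕ} {X : ℕ → Set Plane}
    {Y : ℕ → Set ℝ} (v : ℕ) (s : State) (h1 : s.num 1 = 1) (h2 : s.num 2 = 0) (hv : s.num a = v)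
    (hp : ∀ u < v, ∀ s' : State, (∀ b < a, s'.num b = s.num b) → s'.num a = u →
      Emits C p s' B (a + 1) (X u) (Y u)) :
    Emits C (countdown a p) s (v * (B + 2) + 1) a (⋃ u < v, X u) (⋃ u < v, Y u) := by
  induction v generalizing s with
  | zero =>
    refine ⟨s, 1, Run.loopStop ?_, by omega, fun _ _ => rfl, fun q => ?_, fun r => ?_⟩
    · simp [Test.Holds, State.getNum, State.loc, h2, hv]
    · simp
    · simp
  | succ v ih =>
    set s₁ : State := (Instr.subNum (.cell a) (.cell a) (.cell 1)).apply C s with hs₁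
    have hnum₁ : ∀ b < a, s₁.num b = s.num b := fun b hb => by
      simp [hs₁, Instr.apply, State.putNum, State.loc, Function.update_of_ne hb.ne]
    have hv₁ : s₁.num a = v := by
      simp [hs₁, Instr.apply, State.putNum, State.loc, State.getNum, h1, hv]
    obtain ⟨s₂, t, hr, ht, hnum₂, hX, hY⟩ := hp v v.lt_succ_self s₁ hnum₁ hv₁
    have hnum : ∀ b < a, s₂.num b = s.num b := fun b hb =>
      (hnum₂ b (by omega)).trans (hnum₁ b hb)
    obtain ⟨s₃, t', hr', ht', hnum₃, hX', hY'⟩ := ih s₂ ((hnum 1 (by omega)).trans h1)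
      ((hnum 2 (by omega)).trans h2) ((hnum₂ a a.lt_succ_self).trans hv₁)
      fun u hu s' hs' => hp u (by omega) s' fun b hb => (hs' b hb).trans (hnum b hb)
    refine ⟨s₃, _, Run.loopStep ?_ ((Run.instr _ s).seq hr) hr', ?_,
      fun b hb => (hnum₃ b hb).trans (hnum b hb), fun q => ?_, fun r => ?_⟩
    · simp [Test.Holds, State.getNum, State.loc, h2, hv]
    · rw [Nat.succ_mul]
      omega
    · rw [hX', hX, biUnion_lt_succ, mem_union, or_assoc, or_comm (a := q ∈ X v)]
      rfl
    · rw [hY', hY, biUnion_lt_succ, mem_union, or_assoc, or_comm (a := r ∈ Y v)]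
      rfl

/-! ### The program -/

/-- Output a point equidistant to three objects. -/
def tieBody : Program :=
  .seq (.instr (.equidistant (.cell 0) (.cell 3) (.cell 4) (.cell 5) (.cell 6)))
    (emitWithRadius (.cell 3))

/-- Output all points equidistant to three objects. -/
def tripleBody : Program :=
  .seq (.instr (.countEquidistant (.cell 6) (.cell 3) (.cell 4) (.cell 5))) (countdown 6 tieBody)

/-- Output the critical points of a bisector. -/
def pairBody : Program :=
  .seq (.instr (.bisectorMin (.cell 0) (.cell 3) (.cell 4)))
    (.seq (emitWithRadius (.cell 3))
      (.seq (.instr (.copyNum (.cell 5) (.cell 4))) (countdown 5 tripleBody)))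

/-- Output a point of an object and the critical points of its bisectors with the objects before. -/
def objectBody : Program :=
  .seq (.instr (.somePoint (.cell 0) (.cell 3)))
    (.seq (.instr (.outPt (.cell 0)))
      (.seq (.instr (.copyNum (.cell 4) (.cell 3))) (countdown 4 pairBody)))

/-- Output the candidate points and the candidate radii. -/
def candidateProgram : Program :=
  .seq (.instr (.setNum (.cell 1) 1))
    (.seq (.instr (.copyNum (.cell 3) (.cell 0)))
      (.seq (.instr (.setReal (.cell 0) 0))
        (.seq (.instr (.outRadius (.cell 0))) (countdown 3 objectBody))))

/-- The equidistant points of the objects with numbers `i`, `j` and `l`, as computed. -/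
noncomputable def tieList (C : Fin n → Set Plane) (i j l : ℕ) : List Plane :=
  equidistantList (object C i) (object C j) (object C l)

/-! ### Outputs and step counts of the nested loops. -/

theorem emits_tieBody (s : State) :
    Emits C tieBody s 4 7 {(tieList C (s.num 3) (s.num 4) (s.num 5)).getD (s.num 6) 0}
      {infDist ((tieList C (s.num 3) (s.num 4) (s.num 5)).getD (s.num 6) 0)
        (object C (s.num 3))} :=
  Emits.instr_seq (emits_emitWithRadius 3 _ 7) (fun _ _ => rfl) rfl rfl

/-- The loop index stays below the length, so the default `d` never occurs among the outputs. -/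
theorem biUnion_getD {α β : Type*} (L : List α) (d : α) (f : α → β) :
    ⋃ u < L.length, ({f (L.getD u d)} : Set β) = {b | ∃ a ∈ L, b = f a} := by
  ext b
  simp only [mem_iUnion, mem_singleton_iff, exists_prop, mem_ofPred_eq]
  constructor
  · rintro ⟨u, hu, rfl⟩
    rw [List.getD_eq_getElem _ _ hu]
    exact ⟨_, List.getElem_mem hu, rfl⟩
  · rintro ⟨a, ha, rfl⟩
    obtain ⟨u, hu, rfl⟩ := List.getElem_of_mem ha
    exact ⟨u, hu, by rw [List.getD_eq_getElem _ _ hu]⟩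

theorem emits_tripleBody {c : ℕ} (s : State) (h1 : s.num 1 = 1) (h2 : s.num 2 = 0)
    (hc : (tieList C (s.num 3) (s.num 4) (s.num 5)).length ≤ c) :
    Emits C tripleBody s (6 * c + 2) 6
      {p | ∃ q ∈ tieList C (s.num 3) (s.num 4) (s.num 5), p = q}
      {r | ∃ q ∈ tieList C (s.num 3) (s.num 4) (s.num 5), r = infDist q (object C (s.num 3))} := by
  set L := tieList C (s.num 3) (s.num 4) (s.num 5) with hL
  rw [← biUnion_getD L 0 fun q => q, ← biUnion_getD L 0 fun q => infDist q (object C (s.num 3))]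
  have hle : L.length * (4 + 2) ≤ c * 6 := Nat.mul_le_mul_right _ hc
  refine (Emits.instr_seq (o := .countEquidistant (.cell 6) (.cell 3) (.cell 4) (.cell 5))
    (emits_countdown (a := 6) (p := tieBody) (B := 4) (by norm_num) L.length _ h1 h2 rfl ?_)
    (fun a ha => Function.update_of_ne ha.ne _ _) rfl rfl).mono (by omega) le_rfl
  · intro u _ s' hs' hu
    have h3 : s'.num 3 = s.num 3 := hs' 3 (by norm_num)
    have h4 : s'.num 4 = s.num 4 := hs' 4 (by norm_num)
    have h5 : s'.num 5 = s.num 5 := hs' 5 (by norm_num)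
    have := emits_tieBody (C := C) s'
    rwa [h3, h4, h5, hu, ← hL] at this

/-- The points output for the pair of the objects with numbers `i` and `j`. -/
def pairPoints (C : Fin n → Set Plane) (i j : ℕ) : Set Plane :=
  {p | p = bisectorMin (object C i) (object C j) ∨ ∃ l < j, p ∈ tieList C i j l}

theorem emits_pairBody {c N : ℕ} (s : State) (h1 : s.num 1 = 1) (h2 : s.num 2 = 0)
    (hN : s.num 4 ≤ N) (hc : ∀ l < s.num 4, (tieList C (s.num 3) (s.num 4) l).length ≤ c) :
    Emits C pairBody s (N * (6 * c + 4) + 6) 5 (pairPoints C (s.num 3) (s.num 4))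
      ((fun p => infDist p (object C (s.num 3))) '' pairPoints C (s.num 3) (s.num 4)) := by
  set L := tieList C (s.num 3) (s.num 4) with hL
  have hle : s.num 4 * (6 * c + 2 + 2) ≤ N * (6 * c + 4) := Nat.mul_le_mul_right _ hN
  have key := Emits.instr_seq (C := C)
    (o := .bisectorMin (.cell 0) (.cell 3) (.cell 4)) (s := s) (m := 5)
    ((emits_emitWithRadius 3 _ 5).seq le_rfl fun s' hs' =>
      Emits.instr_seq (o := .copyNum (.cell 5) (.cell 4))
        (emits_countdown (p := tripleBody) (B := 6 * c + 2)
        (X := fun l => {p | ∃ q ∈ L l, p = q})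
        (Y := fun l => {r | ∃ q ∈ L l, r = infDist q (object C (s.num 3))})
        (by norm_num) (s.num 4) _ ((hs' 1 (by norm_num)).trans h1)
        ((hs' 2 (by norm_num)).trans h2) (hs' 4 (by norm_num)) ?_)
        (fun a ha => Function.update_of_ne ha.ne _ _) rfl rfl)
    (fun _ _ => rfl) rfl rfl
  · unfold pairBody
    convert key.mono (B' := N * (6 * c + 4) + 6) (by omega) le_rfl using 1
    · ext p
      simp [pairPoints, hL, Instr.apply, State.putPt, State.getNum, State.loc]
    · ext r
      simp only [pairPoints, hL, Instr.apply, State.putPt, State.getNum, State.loc, mem_image,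
        mem_ofPred_eq, mem_union, mem_singleton_iff, mem_iUnion, exists_prop, Function.update_self]
      constructor
      · rintro ⟨p, rfl | ⟨l, hl, hp⟩, rfl⟩
        · exact Or.inl rfl
        · exact Or.inr ⟨l, hl, p, hp, rfl⟩
      · rintro (rfl | ⟨l, hl, p, hp, rfl⟩)
        · exact ⟨_, Or.inl rfl, rfl⟩
        · exact ⟨p, Or.inr ⟨l, hl, hp⟩, rfl⟩
  · intro l hl s'' hs'' hsl
    have h3 : s''.num 3 = s.num 3 := (hs'' 3 (by norm_num)).trans (hs' 3 (by norm_num))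
    have h4 : s''.num 4 = s.num 4 := (hs'' 4 (by norm_num)).trans (hs' 4 (by norm_num))
    have := emits_tripleBody (C := C) (c := c) s''
      ((hs'' 1 (by norm_num)).trans ((hs' 1 (by norm_num)).trans h1))
      ((hs'' 2 (by norm_num)).trans ((hs' 2 (by norm_num)).trans h2))
      (by rw [h3, h4, hsl]; exact hc l hl)
    rwa [h3, h4, hsl] at this

theorem emits_objectBody {c N : ℕ} (s : State) (h1 : s.num 1 = 1) (h2 : s.num 2 = 0)
    (hN : s.num 3 ≤ N)
    (hc : ∀ j < s.num 3, ∀ l < j, (tieList C (s.num 3) j l).length ≤ c) :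
    Emits C objectBody s (N * (N * (6 * c + 4) + 8) + 4) 4
      ({Clustering.somePoint (object C (s.num 3))} ∪ ⋃ j < s.num 3, pairPoints C (s.num 3) j)
      (⋃ j < s.num 3, (fun p => infDist p (object C (s.num 3))) '' pairPoints C (s.num 3) j) := by
  have hle : s.num 3 * (N * (6 * c + 4) + 6 + 2) ≤ N * (N * (6 * c + 4) + 8) :=
    Nat.mul_le_mul_right _ hN
  have key := Emits.instr_seq (C := C) (o := .somePoint (.cell 0) (.cell 3)) (s := s) (m := 4)
    ((emits_outPt _ 4).seq le_rfl fun s' hs' =>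
      Emits.instr_seq (o := .copyNum (.cell 4) (.cell 3))
        (emits_countdown (p := pairBody) (B := N * (6 * c + 4) + 6)
        (X := fun j => pairPoints C (s.num 3) j)
        (Y := fun j => (fun p => infDist p (object C (s.num 3))) '' pairPoints C (s.num 3) j)
        (by norm_num) (s.num 3) _ ((hs' 1 (by norm_num)).trans h1)
        ((hs' 2 (by norm_num)).trans h2) (hs' 3 (by norm_num)) ?_)
        (fun a ha => Function.update_of_ne ha.ne _ _) rfl rfl)
    (fun _ _ => rfl) rfl rfl
  · rw [empty_union] at key
    exact key.mono (by omega) le_rfl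
  · intro j hj s'' hs'' hsj
    have h3 : s''.num 3 = s.num 3 := (hs'' 3 (by norm_num)).trans (hs' 3 (by norm_num))
    have := emits_pairBody (C := C) (c := c) (N := N) s''
      ((hs'' 1 (by norm_num)).trans ((hs' 1 (by norm_num)).trans h1))
      ((hs'' 2 (by norm_num)).trans ((hs' 2 (by norm_num)).trans h2))
      (by omega) (by rw [h3, hsj]; exact hc j hj)
    rwa [h3, hsj] at this

theorem emits_candidateProgram {c : ℕ}
    (hc : ∀ i < n, ∀ j < i, ∀ l < j, (tieList C i j l).length ≤ c) :
    Emits C candidateProgram (startState n) (n * (n * (n * (6 * c + 4) + 8) + 6) + 5) 0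
      (⋃ i < n, ({Clustering.somePoint (object C i)} ∪ ⋃ j < i, pairPoints C i j))
      ({0} ∪ ⋃ i < n, ⋃ j < i, (fun p => infDist p (object C i)) '' pairPoints C i j) := by
  have key := Emits.instr_seq (C := C) (o := .setNum (.cell 1) 1) (s := startState n) (m := 0)
    (Emits.instr_seq (o := .copyNum (.cell 3) (.cell 0))
      (Emits.instr_seq (o := .setReal (.cell 0) 0)
        ((emits_outRadius _ 4).seq (by norm_num) fun s' hs' =>
        (emits_countdown (p := objectBody) (B := n * (n * (6 * c + 4) + 8) + 4)
        (X := fun i => {Clustering.somePoint (object C i)} ∪ ⋃ j < i, pairPoints C i j)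
        (Y := fun i => ⋃ j < i, (fun p => infDist p (object C i)) '' pairPoints C i j)
        le_rfl n s' ((hs' 1 (by norm_num)).trans ?_) ((hs' 2 (by norm_num)).trans ?_)
        ((hs' 3 (by norm_num)).trans ?_) ?_).mono le_rfl (Nat.zero_le 3))
        (fun _ _ => rfl) rfl rfl)
      (fun _ h => absurd h (Nat.not_lt_zero _)) rfl rfl)
    (fun _ h => absurd h (Nat.not_lt_zero _)) rfl rfl
  · rw [empty_union] at key
    unfold candidateProgram
    have hle : n * (n * (n * (6 * c + 4) + 8) + 4 + 2) ≤ n * (n * (n * (6 * c + 4) + 8) + 6) :=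
      le_rfl
    convert key.mono (B' := n * (n * (n * (6 * c + 4) + 8) + 6) + 5) (by omega) le_rfl using 2
    simp [Instr.apply, State.putReal, State.loc]
  · simp [Instr.apply, State.putNum, State.putReal, State.loc]
  · simp [Instr.apply, State.putNum, State.putReal, State.loc, startState]
  · simp [Instr.apply, State.putNum, State.putReal, State.loc, State.getNum, startState]
  · intro i hi s'' hs'' hsi
    have := emits_objectBody (C := C) (c := c) (N := n) s''
      ((hs'' 1 (by norm_num)).trans ((hs' 1 (by norm_num)).trans (by
        simp [Instr.apply, State.putNum, State.putReal, State.loc])))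
      ((hs'' 2 (by norm_num)).trans ((hs' 2 (by norm_num)).trans (by
        simp [Instr.apply, State.putNum, State.putReal, State.loc, startState])))
      (by omega) (by rw [hsi]; exact hc i hi)
    rwa [hsi] at this

/-- One step outputs at most one item, so the running time also bounds the sizes of `P` and `R`. -/
theorem Run.length_output_le {p : Program} {s s' : State} {t : ℕ} (h : Run C p s s' t) :
    s'.outPts.length + s'.outRadii.length ≤ s.outPts.length + s.outRadii.length + t := by
  induction h with
  | instr o s =>
    cases o <;> simp [Instr.apply, State.putNum, State.putReal, State.putPt] <;> omega
  | seq => omega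
  | iteTrue => omega
  | iteFalse => omega
  | loopStop => omega
  | loopStep => omega

/-! ### The computed sets are the candidate sets. -/

theorem object_fin (i : Fin n) : object C i = C i := by
  simp [object]

theorem tieList_fin {c : ℕ} (hC : IsInput c C) {i j l : Fin n} (hji : j < i) (hlj : l < j) :
    (tieList C i j l).length ≤ c ∧
      ∀ p, p ∈ tieList C i j l ↔ p ∈ equidistantPoints (C i) (C j) (C l) := by
  have hli := hlj.trans hji
  have hf := hC.finite_equidistantPoints hji.ne' hli.ne' hlj.ne'
  have hm := hC.meet i j l hji.ne' hli.ne' hlj.ne'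
  have e : tieList C i j l = hf.toFinset.toList := by
    rw [tieList, object_fin, object_fin, object_fin]
    exact dif_pos hf
  rw [e]
  refine ⟨?_, fun p => by simp⟩
  rw [Finset.length_toList]
  rw [hf.encard_eq_coe_toFinset_card] at hm
  exact_mod_cast hm

theorem candidatePoints_eq {c : ℕ} (hC : IsInput c C) :
    (⋃ i < n, ({Clustering.somePoint (object C i)} ∪ ⋃ j < i, pairPoints C i j)) =
      candidatePoints C := by
  ext p
  simp only [mem_iUnion, mem_union, mem_singleton_iff, exists_prop, pairPoints, mem_ofPred_eq,
    candidatePoints]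
  constructor
  · rintro ⟨i, hi, rfl | ⟨j, hj, rfl | ⟨l, hl, hp⟩⟩⟩
    · exact ⟨⟨i, hi⟩, Or.inl (congrArg Clustering.somePoint (object_fin ⟨i, hi⟩))⟩
    · exact ⟨⟨i, hi⟩, Or.inr ⟨⟨j, hj.trans hi⟩, hj, 
        Or.inl (congrArg₂ Clustering.bisectorMin (object_fin ⟨i, hi⟩)
          (object_fin ⟨j, hj.trans hi⟩))⟩⟩
    · refine ⟨⟨i, hi⟩, Or.inr ⟨⟨j, hj.trans hi⟩, hj, Or.inr ?_⟩⟩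
      have hlj : (⟨l, hl.trans (hj.trans hi)⟩ : Fin n) < ⟨j, hj.trans hi⟩ := hl
      have hji : (⟨j, hj.trans hi⟩ : Fin n) < ⟨i, hi⟩ := hj
      exact ⟨⟨l, hl.trans (hj.trans hi)⟩, (hlj.trans hji).ne, hlj.ne,
        ((tieList_fin hC hji hlj).2 p).1 hp⟩
  · rintro ⟨i, rfl | ⟨j, hj, rfl | hp⟩⟩
    · exact ⟨i, i.2, Or.inl (by rw [object_fin])⟩
    · exact ⟨i, i.2, Or.inr ⟨j, hj, Or.inl (by simp only [object_fin])⟩⟩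
    · obtain ⟨a, b, l, hlb, hba, hp, -⟩ := exists_sorted_of_mem_tiePoints hj.ne' hp
      exact ⟨a, a.2, Or.inr ⟨b, hba, Or.inr ⟨l, hlb, ((tieList_fin hC hba hlb).2 p).2 hp⟩⟩⟩

theorem candidateRadii_eq {c : ℕ} (hC : IsInput c C) :
    ({0} ∪ ⋃ i < n, ⋃ j < i, (fun p => infDist p (object C i)) '' pairPoints C i j) =
      candidateRadii C := by
  ext r
  simp only [mem_iUnion, mem_union, mem_singleton_iff, exists_prop, pairPoints, mem_ofPred_eq,
    candidateRadii, mem_image]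
  refine or_congr_right ?_
  constructor
  · rintro ⟨i, hi, j, hj, p, hp, rfl⟩
    have hji : (⟨j, hj.trans hi⟩ : Fin n) < ⟨i, hi⟩ := hj
    refine ⟨⟨i, hi⟩, ⟨j, hj.trans hi⟩, hji, p, ?_,
      congrArg (infDist p) (object_fin ⟨i, hi⟩)⟩
    obtain rfl | ⟨l, hl, hp⟩ := hp
    · exact Or.inl (congrArg₂ Clustering.bisectorMin (object_fin ⟨i, hi⟩)
        (object_fin ⟨j, hj.trans hi⟩))
    · have hlj : (⟨l, hl.trans (hj.trans hi)⟩ : Fin n) < ⟨j, hj.trans hi⟩ := hl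
      exact Or.inr ⟨⟨l, hl.trans (hj.trans hi)⟩, (hlj.trans hji).ne, hlj.ne,
        ((tieList_fin hC hji hlj).2 p).1 hp⟩
  · rintro ⟨i, j, hj, p, rfl | hp, rfl⟩
    · exact ⟨i, i.2, j, hj, _, Or.inl rfl, by simp only [object_fin]⟩
    · obtain ⟨a, b, l, hlb, hba, hp, he⟩ := exists_sorted_of_mem_tiePoints hj.ne' hp
      exact ⟨a, a.2, b, hba, p, Or.inr ⟨l, hlb, ((tieList_fin hC hba hlb).2 p).2 hp⟩,
        by rw [object_fin, he]⟩

theorem computes_candidates {c : ℕ} (hn : 1 ≤ n) (hC : IsInput c C) :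
    ∃ (t : ℕ) (P : Finset Plane) (R : Finset ℝ), Computes C candidateProgram t P R ∧
      t ≤ (6 * c + 23) * n ^ 3 ∧ P.card ≤ t ∧ R.card ≤ t ∧
      (P : Set Plane) = candidatePoints C ∧ (R : Set ℝ) = candidateRadii C := by
  classical
  obtain ⟨s, t, hr, ht, -, hX, hY⟩ := emits_candidateProgram (C := C) (c := c)
    fun i hi j hj l hl => (tieList_fin hC (i := ⟨i, hi⟩) (j := ⟨j, hj.trans hi⟩)
      (l := ⟨l, hl.trans (hj.trans hi)⟩) hj hl).1
  rw [candidatePoints_eq hC] at hX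
  rw [candidateRadii_eq hC] at hY
  have hlen := hr.length_output_le
  simp only [startState, List.length_nil, zero_add] at hlen
  refine ⟨t, s.outPts.toFinset, s.outRadii.toFinset, ⟨s, hr, ?_, ?_⟩, ?_, ?_, ?_, ?_, ?_⟩
  · ext p
    simp
  · ext r
    simp
  · refine ht.trans ?_
    -- The step bound expands to `(6c + 4)n³ + 8n² + 6n + 5`, and `4 + 8 + 6 + 5 = 23`.
    have h1 : n ≤ n ^ 3 := Nat.le_self_pow (by norm_num) n
    have h2 : n ^ 2 ≤ n ^ 3 := Nat.pow_le_pow_right hn (by norm_num)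
    nlinarith
  · exact (List.toFinset_card_le _).trans (by omega)
  · exact (List.toFinset_card_le _).trans (by omega)
  · ext p
    simp [hX, startState]
  · ext r
    simp [hY, startState]

end Programs

end Clustering

theorem mainTheorem6 :
    ∃ prog : Clustering.Program, ∀ c : ℕ, ∃ K : ℝ,
      ∀ (n : ℕ) (C : Fin n → Set Clustering.Plane), 1 ≤ n → Clustering.IsInput c C →
      ∃ (t : ℕ) (P : Finset Clustering.Plane) (R : Finset ℝ),
        -- the running time and the sizes of the sets
        Clustering.Computes C prog t P R ∧
        (t : ℝ) ≤ K * ((n : ℝ) ^ 3 * Real.log ((n : ℝ) + 1)) ∧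
        (P.card : ℝ) ≤ K * (n : ℝ) ^ 3 ∧
        (R.card : ℝ) ≤ K * (n : ℝ) ^ 3 ∧
        -- for every number of centers there is an optimal solution inside `P`
        (∀ k : ℕ, ∃ S ⊆ P, S.card = min k P.card ∧ Clustering.IsOptimal C k S ∧
          (1 ≤ k → Clustering.radius C S ≠ ⊤ ∧ (Clustering.radius C S).toReal ∈ R)) ∧
        -- every candidate is of one of the three kinds
        (∀ p ∈ P, (∃ i, p ∈ C i) ∨ ∃ i j, i ≠ j ∧ Clustering.IsBisectorCandidate C i j p) ∧
        (∀ r ∈ R, r = 0 ∨ ∃ i j, i ≠ j ∧ ∃ p ∈ P,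
          Clustering.IsBisectorCandidate C i j p ∧ r = Metric.infDist p (C i)) ∧
        -- the candidates contain a point of every object, all points equidistant to three objects,
        -- and a point of minimum distance on every arc between them
        (∀ i, ∃ p ∈ P, p ∈ C i) ∧
        (∀ i j, i ≠ j → Clustering.tiePoints C i j ⊆ (P : Set Clustering.Plane)) ∧
        (∀ i j, i ≠ j → ∀ A, Clustering.IsArc C i j A →
          ∃ p ∈ P, Clustering.IsDistMin (C i) A p) := by
  refine ⟨Clustering.candidateProgram, fun c => ⟨2 * (6 * c + 23), fun n C hn hC => ?_⟩⟩
  obtain ⟨t, P, R, hcomp, ht, hPt, hRt, hP, hR⟩ := Clustering.computes_candidates hn hC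
  have memP : ∀ p, p ∈ P ↔ p ∈ Clustering.candidatePoints C := fun p => by
    rw [← hP, Finset.mem_coe]
  have memR : ∀ r, r ∈ R ↔ r ∈ Clustering.candidateRadii C := fun r => by
    rw [← hR, Finset.mem_coe]
  have htR : (t : ℝ) ≤ (6 * c + 23) * (n : ℝ) ^ 3 := by exact_mod_cast ht
  have hpos : 0 ≤ (6 * (c : ℝ) + 23) * (n : ℝ) ^ 3 := by positivity
  -- The cubic bound passes to the one with a logarithm at the cost of the factor 2 in the constant.
  have hlog : 1 / 2 ≤ Real.log ((n : ℝ) + 1) := by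
    have h2 : (2 : ℝ) ≤ n + 1 := by
      have : (1 : ℝ) ≤ n := by exact_mod_cast hn
      linarith
    linarith [Real.log_two_gt_d9, Real.log_le_log two_pos h2]
  have hP' : (P.card : ℝ) ≤ t := by exact_mod_cast hPt
  have hR' : (R.card : ℝ) ≤ t := by exact_mod_cast hRt
  refine ⟨t, P, R, hcomp, by nlinarith, by linarith, by linarith, fun k => ?_, fun p hp => ?_,
    fun r hr => ?_, fun i => ?_, fun i j hij => ?_, fun i j hij A hA => ?_⟩
  · simpa only [memR] using Clustering.exists_isOptimal hn hC hP k
  · exact Clustering.candidatePoints_kinds hC ((memP p).1 hp)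
  · simpa only [memP] using Clustering.candidateRadii_kinds hC ((memR r).1 hr)
  · exact ⟨_, (memP _).2 ⟨i, Or.inl rfl⟩, Clustering.somePoint_mem hC i⟩
  · rw [hP]
    exact Clustering.tiePoints_subset_candidatePoints hij
  · simpa only [memP] using hA.exists_candidate hC hij
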